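/- **Lemma 6.3 (Color Global Absorber).** *Notation.* Digraphs are finite, without loops or multiple edges (both $(u,v)$ and $(v,u)$ may be edges). For $\star\in\{\rightarrow,\leftarrow\}$ let $(uv)^{\rightarrow}=(u,v)$ and $(uv)^{\leftarrow}=(v,u)$. For an edge-colored digraph $D$ with vertex set $V(D)$ and edge set $E(D)$ let $\mathcal C(D)$ be the set of colors on its edges and $E_c(D)$ the set of edges of color $c$. Let $N^\star(v)=\{u:(vu)^\star\in E(D)\}$, let $d^\star_c(v)$ be the number of $u$ such that $(vu)^\star$ is an edge of color $c$, and let $\mathcal C^\star(v)$ be the set of colors on edges of the form $(vu)^\star$. A directed path of length $k$ and orientation $\star\in\{\rightarrow,\leftarrow\}^k$ from $v_1$ to $v_{k+1}$ is a digraph on distinct vertices $v_1,\dots,v_{k+1}$ whose edges are exactly $(v_iv_{i+1})^{\star_i}$, $i\in[k]$. A colored digraph is rainbow if no two of its edges have the same color. For a set $S$ of vertices and/or colors, $V(S)$ and $\mathcal C(S)$ are the sets of vertices and of colors in $S$. *Absorbers.* Let $\mathcal S$ be a collection of sets of vertices and/or colors such that all $|V(S)|$, $S\in\mathcal S$, are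 equal and all $|\mathcal C(S)|$, $S\in\mathcal S$, are equal. For $\star\in\{\rightarrow,\leftarrow\}^k$, an $(\mathcal S,\star)$-absorber is a triple $(A,s,t)$, where $A$ is a colored digraph and $s,t\in V(A)$, such that for every $S\in\mathcal S$ there is a rainbow directed path $P_S$ in $A$ of length $k$ and orientation $\star$ from $s$ to $t$ with $$V(P_S)=\bigl(V(A)\setminus V(\textstyle\bigcup\mathcal S)\bigr)\cup V(S),\qquad \mathcal C(P_S)=\bigl(\mathcal C(A)\setminus \mathcal C(\textstyle\bigcup\mathcal S)\bigr)\cup \mathcal C(S).$$ The sets $V(A)\setminus V(\bigcup\mathcal S)$ and $\mathcal C(A)\setminus\mathcal C(\bigcup\mathcal S)$ are the internal vertices and internal colors of $A$. An absorber in $D$ is one for which $A$ is a subdigraph of $D$ with the inherited coloring. For a set $X$ of colors, $\binom Xm$ is the collection of its $m$-element subsets. *Pseudorandomness.* An edge-colored digraph $D$ is $(n,\alpha,\varepsilon)$-edge-color pseudorandom if 1. $|V(D)|=|\mathcal C(D)|=n$, and $|N^\star(v)|\ge\alpha n$ for all $v\in V(D)$ and $\star\in\{\rightarrow,\leftarrow\}$;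 2. for all $U,W\subseteq V(D)$ and $\mathcal C'\subseteq\mathcal C(D)$, each of size at least $\varepsilon n$, and each $\star\in\{\rightarrow,\leftarrow\}$, there are $u\in U$ and $w\in W$ such that $(uw)^\star$ is an edge with color in $\mathcal C'$; 3. $d^\star_c(v)\le n/\log n$ for all $c\in\mathcal C(D)$, $v\in V(D)$ and $\star\in\{\rightarrow,\leftarrow\}$; 4. for every $c\in\mathcal C(D)$, $E_c(D)$ contains a matching (a set of pairwise vertex-disjoint edges) of size at least $\alpha n/3$; 5. $|E_c(D)|\le 10n$ for every $c\in\mathcal C(D)$; 6. $|\mathcal C^\star(v)|\ge\alpha n/2$ for all $v\in V(D)$ and $\star\in\{\rightarrow,\leftarrow\}$. An $n$-vertex edge-colored digraph $D$ is $\nu$-color-gadget pseudorandom if for all $V'\subseteq V(D)$ and $\mathcal C'\subseteq\mathcal C(D)$ with $|V'|,|\mathcal C'|\ge(1-\nu)n$, all $c_1,c_2\in\mathcal C(D)$ and all $\star\in\{\rightarrow,\leftarrow\}^7$, there is a $(\{\{c_1\},\{c_2\}\},\star)$-absorber in $D$ with internal vertices in $V'$ and internal colors in $\mathcal C'$. *Statement.*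 For every $\alpha\in(0,1]$ there is $\nu_0>0$ such that for every $\nu\in(0,\nu_0]$ there is $\mu_0>0$ such that for every $\mu\in(0,\mu_0]$ and every $\beta\in(0,\mu]$ there is $\varepsilon_0>0$ such that for every $\varepsilon\in(0,\varepsilon_0]$ there is $n_0$ such that for every $n\ge n_0$ the following holds. Let $D$ be an $(n,\alpha,\varepsilon)$-edge-color pseudorandom and $4\nu$-color-gadget pseudorandom digraph. Let $m=\lfloor\mu n\rfloor$, let $k=2784\cdot 3m-3$, and let $\star\in\{\rightarrow,\leftarrow\}^{k}$. Then for every $V'\subseteq V(D)$ and $\mathcal C'\subseteq\mathcal C(D)$ with $|V'|,|\mathcal C'|\ge(1-\nu)n$ and for every $X\subseteq\mathcal C(D)$ with $|X|=\lfloor\mu n\rfloor+\lfloor\beta n\rfloor$, there is a $\bigl(\binom{X}{m},\star\bigr)$-absorber in $D$ with internal vertices in $V'$ and internal colors in $\mathcal C'$. -/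

import Mathlib

/-- One of the two directions `→` and `←`. -/
inductive Dir
  | fwd
  | bwd

/-- A finite edge-coloured digraph with vertices taken from `V` and colours taken from `C`:
no loops, no multiple edges (antiparallel edges are allowed), and every edge has one colour.
`Arc u v c` says that there is an edge from `u` to `v` and that its colour is `c`. -/
structure ColoredDigraph (V C : Type*) where
  verts : Set V
  Arc : V → V → C → Prop
  finite_verts : verts.Finite
  arc_left_mem : ∀ {u v c}, Arc u v c → u ∈ verts
  arc_right_mem : ∀ {u v c}, Arc u v c → v ∈ verts
  arc_ne : ∀ {u v c}, Arc u v c → u ≠ v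
  arc_unique : ∀ {u v c c'}, Arc u v c → Arc u v c' → c = c'

namespace ColoredDigraph

variable {V C : Type*}

/-- The set of colours that appear on the edges of `D`. -/
def colors (D : ColoredDigraph V C) : Set C := {c | ∃ u v, D.Arc u v c}

/-- The edge set of `D`, as a set of ordered pairs. -/
def edges (D : ColoredDigraph V C) : Set (V × V) := {e | ∃ c, D.Arc e.1 e.2 c}

/-- The set of edges of `D` of colour `c`. -/
def edgesOfColor (D : ColoredDigraph V C) (c : C) : Set (V × V) := {e | D.Arc e.1 e.2 c}

/-- The ordered pair `(uv)^d`: the pair `(u, v)` for `d = →` and `(v, u)` for `d = ←`. -/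
def orient : Dir → V → V → V × V
  | .fwd, u, v => (u, v)
  | .bwd, u, v => (v, u)

/-- `D.DArc d u v c`: the pair `(uv)^d` is an edge of `D`, of colour `c`. -/
def DArc (D : ColoredDigraph V C) (d : Dir) (u v : V) (c : C) : Prop :=
  D.Arc (orient d u v).1 (orient d u v).2 c

/-- The out-neighbourhood (for `d = →`) or in-neighbourhood (for `d = ←`) of `v`. -/
def nbhd (D : ColoredDigraph V C) (d : Dir) (v : V) : Set V := {u | ∃ c, D.DArc d v u c}

/-- The vertices `u` such that `(vu)^d` is an edge of colour `c`. -/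
def nbhdOfColor (D : ColoredDigraph V C) (d : Dir) (c : C) (v : V) : Set V :=
  {u | D.DArc d v u c}

/-- The colours of the edges of the form `(vu)^d`. -/
def colorsAt (D : ColoredDigraph V C) (d : Dir) (v : V) : Set C := {c | ∃ u, D.DArc d v u c}

/-- No two distinct edges (antiparallel ones included) have the same colour. -/
def IsRainbow (D : ColoredDigraph V C) : Prop :=
  ∀ ⦃u v u' v' : V⦄ ⦃c : C⦄, D.Arc u v c → D.Arc u' v' c → u = u' ∧ v = v'

/-- `A` is a subdigraph of `D`, with the colours inherited from `D`. -/
def IsSubdigraph (A D : ColoredDigraph V C) : Prop :=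
  A.verts ⊆ D.verts ∧ ∀ ⦃u v : V⦄ ⦃c : C⦄, A.Arc u v c → D.Arc u v c

/-- `P` is a directed path of length `k` with orientation `σ`, from `s` to `t`: its vertices are
distinct `p 0 = s, p 1, …, p k = t`, and its edges are exactly the `(p i, p (i + 1))^(σ i)`. -/
def IsDirectedPath (P : ColoredDigraph V C) {k : ℕ} (σ : Fin k → Dir) (s t : V) : Prop :=
  ∃ p : Fin (k + 1) → V, Function.Injective p ∧ P.verts = Set.range p ∧
    P.edges = {e | ∃ i : Fin k, e = orient (σ i) (p i.castSucc) (p i.succ)} ∧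
    p 0 = s ∧ p (Fin.last k) = t

/-- The set of vertices that appear in a set of vertices and colours. -/
def vertexPart (S : Set (V ⊕ C)) : Set V := {v | Sum.inl v ∈ S}

/-- The set of colours that appear in a set of vertices and colours. -/
def colorPart (S : Set (V ⊕ C)) : Set C := {c | Sum.inr c ∈ S}

/-- The internal vertices of `A` with respect to the collection `𝒮`. -/
def internalVerts (A : ColoredDigraph V C) (𝒮 : Set (Set (V ⊕ C))) : Set V :=
  A.verts \ vertexPart (⋃₀ 𝒮)

/-- The internal colours of `A` with respect to the collection `𝒮`. -/
def internalColors (A : ColoredDigraph V C) (𝒮 : Set (Set (V ⊕ C))) : Set C :=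
  A.colors \ colorPart (⋃₀ 𝒮)

/-- `(A, s, t)` is an `(𝒮, σ)`-absorber. -/
def IsAbsorber (A : ColoredDigraph V C) (s t : V) (𝒮 : Set (Set (V ⊕ C)))
    {k : ℕ} (σ : Fin k → Dir) : Prop :=
  (∀ S ∈ 𝒮, ∀ T ∈ 𝒮, (vertexPart S).encard = (vertexPart T).encard ∧
    (colorPart S).encard = (colorPart T).encard) ∧
  s ∈ A.verts ∧ t ∈ A.verts ∧
  ∀ S ∈ 𝒮, ∃ P : ColoredDigraph V C, P.IsSubdigraph A ∧ P.IsRainbow ∧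
    P.IsDirectedPath σ s t ∧
    P.verts = A.internalVerts 𝒮 ∪ vertexPart S ∧
    P.colors = A.internalColors 𝒮 ∪ colorPart S

/-- `D` contains an `(𝒮, σ)`-absorber whose internal vertices lie in `V'` and whose internal
colours lie in `C'`. -/
def HasAbsorber (D : ColoredDigraph V C) (𝒮 : Set (Set (V ⊕ C))) {k : ℕ} (σ : Fin k → Dir)
    (V' : Set V) (C' : Set C) : Prop :=
  ∃ (A : ColoredDigraph V C) (s t : V), A.IsSubdigraph D ∧ A.IsAbsorber s t 𝒮 σ ∧
    A.internalVerts 𝒮 ⊆ V' ∧ A.internalColors 𝒮 ⊆ C'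

/-- The collection `{{c₁}, {c₂}}` for two colours `c₁`, `c₂`. -/
def colorPair (c₁ c₂ : C) : Set (Set (V ⊕ C)) := {{Sum.inr c₁}, {Sum.inr c₂}}

/-- The collection of all `m`-element subsets of the set `X` of colours. -/
def colorSubsets (X : Set C) (m : ℕ) : Set (Set (V ⊕ C)) :=
  {S | ∃ U : Set C, U ⊆ X ∧ U.encard = m ∧ S = Sum.inr '' U}

/-- `(n, α, ε)`-edge-colour pseudorandomness. -/
structure IsEdgeColorPseudorandom (D : ColoredDigraph V C) (n : ℕ) (α ε : ℝ) : Prop where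
  card_verts : D.verts.ncard = n
  card_colors : D.colors.ncard = n
  /-- the minimum semi-degree is at least `α n` -/
  semidegree : ∀ v ∈ D.verts, ∀ d : Dir, α * n ≤ (D.nbhd d v).ncard
  exists_edge : ∀ U W : Set V, U ⊆ D.verts → W ⊆ D.verts → ∀ C' : Set C, C' ⊆ D.colors →
    ε * n ≤ U.ncard → ε * n ≤ W.ncard → ε * n ≤ C'.ncard →
    ∀ d : Dir, ∃ u ∈ U, ∃ w ∈ W, ∃ c ∈ C', D.DArc d u w c
  color_degree : ∀ c ∈ D.colors, ∀ v ∈ D.verts, ∀ d : Dir,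
    ((D.nbhdOfColor d c v).ncard : ℝ) ≤ n / Real.log n
  /-- every colour class contains a matching (pairwise vertex-disjoint edges) of size `α n / 3` -/
  color_matching : ∀ c ∈ D.colors, ∃ M : Finset (V × V),
    (∀ e ∈ M, e ∈ D.edgesOfColor c) ∧
    (∀ e ∈ M, ∀ f ∈ M, e ≠ f → e.1 ≠ f.1 ∧ e.1 ≠ f.2 ∧ e.2 ≠ f.1 ∧ e.2 ≠ f.2) ∧
    α * n / 3 ≤ M.card
  color_edges : ∀ c ∈ D.colors, (D.edgesOfColor c).ncard ≤ 10 * n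
  color_diversity : ∀ v ∈ D.verts, ∀ d : Dir, α * n / 2 ≤ (D.colorsAt d v).ncard

/-- `ν`-colour-gadget pseudorandomness. -/
def IsColorGadgetPseudorandom (D : ColoredDigraph V C) (ν : ℝ) : Prop :=
  ∀ (V' : Set V) (C' : Set C), V' ⊆ D.verts → C' ⊆ D.colors →
    (1 - ν) * D.verts.ncard ≤ V'.ncard → (1 - ν) * D.verts.ncard ≤ C'.ncard →
    ∀ c₁ ∈ D.colors, ∀ c₂ ∈ D.colors, ∀ σ : Fin 7 → Dir,
      D.HasAbsorber (colorPair c₁ c₂) σ V' C'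

end ColoredDigraph

/-! Absorbing the `m`-subsets of `X` is reduced to perfect matchings. Take a buffer `Y` of `2m`
colours of `C'` outside `X`. A sparse bipartite graph between `X ∪ Y` and `3m` slots
(`exists_robustly_matchable`) matches `U ∪ Y` perfectly to the slots for every `m`-subset `U` of
`X`. If each slot `z` owns a piece of path that can use any one colour of `N z`, with its ends, its
vertices and its other colours fixed, then the concatenation of the pieces realizes every `U ∪ Y`
plus a fixed set of colours. Since `Y` is used every time, its colours are internal.

A piece that chooses among many colours (`flexibleFrom_singletons`) is a chain of pieces that choose
among three, linked by auxiliary colours: one link takes the target and the others pass the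
auxiliary colours along. A three-way choice (`flexibleFrom_three`) combines a switch with two-way
choices. The switch comes from a rainbow `K₃,₆`: a path through `y₀ xᵢ y₁ … y₂ xⱼ y₃ … y₄ xₖ y₅`
keeps its vertex set when the `x`'s are permuted, but changes its colours. Nine two-way choices,
supplied by gadget pseudorandomness, compensate for the change so that in total exactly one of three
given colours is gained.

Pieces are placed greedily and joined by rainbow paths of length three (`Connects`). They use far
fewer than `ν n` vertices and colours, so what remains of `V'` and `C'` always misses at most `4 ν
n`. Each construction works for every word of directions, and surplus length is filled by single
edges (`Extends`), so only upper bounds on lengths matter. Colours are counted as multisets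
throughout; that a trail is rainbow is checked only at the end, where `X`, `Y` and the remaining
reservoir are disjoint. -/

/-! ### Random expanders and a robustly matchable bipartite graph. -/

/-- A union bound: if `18 (L / R) (s / R) ^ d ≤ 1`, then some assignment of `d + 2` elements of a
set of size `R` to every element of a set of size `L` expands all sets of size at most `s`. -/
theorem exists_expander {α β : Type*} [Fintype α] [Fintype β] [DecidableEq α] [DecidableEq β]
    (d s : ℕ) (hβ : 0 < Fintype.card β) (hs : s ≤ Fintype.card β)
    (h : 18 * ((Fintype.card α : ℝ) / Fintype.card β) * ((s : ℝ) / Fintype.card β) ^ d ≤ 1) :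
    ∃ f : α → Fin (d + 2) → β, ∀ A : Finset α, A.card ≤ s →
      A.card ≤ (A.biUnion fun a => Finset.univ.image (f a)).card := by
  classical
  set L := Fintype.card α with hL
  set R := Fintype.card β with hR
  -- `T A B` holds the assignments that send all of `A` into `B`. An assignment is bad if it lies in
  -- some `T A B` with `|A| = |B| ≤ s`.
  let T : Finset α → Finset β → Finset (α → Fin (d + 2) → β) := fun A B =>
    Fintype.piFinset fun a => if a ∈ A then Fintype.piFinset fun _ => B else Finset.univ
  have hTcard : ∀ A B, (T A B).card = (B.card ^ (d + 2)) ^ A.card * (R ^ (d + 2)) ^ (L - A.card) := by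
    intro A B
    rw [Fintype.card_piFinset, ← Finset.prod_mul_prod_compl A]
    congr 1
    · rw [Finset.prod_congr rfl (g := fun _ => B.card ^ (d + 2))]
      · simp
      · intro a ha; simp [ha]
    · rw [Finset.prod_congr rfl (g := fun _ => R ^ (d + 2))]
      · simp [Finset.card_compl, hL]
      · intro a ha; simp [Finset.mem_compl.1 ha, hR]
  let bad : Finset (α → Fin (d + 2) → β) := (Finset.Icc 1 s).biUnion fun a =>
    (Finset.powersetCard a Finset.univ).biUnion fun A =>
      (Finset.powersetCard a Finset.univ).biUnion fun B => T A B
  have hbad : (bad.card : ℝ) ≤ ∑ a ∈ Finset.Icc 1 s,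
      (L.choose a : ℝ) * (R.choose a * (((a : ℝ) ^ (d + 2)) ^ a * ((R : ℝ) ^ (d + 2)) ^ (L - a))) := by
    have : bad.card ≤ ∑ a ∈ Finset.Icc 1 s,
        L.choose a * (R.choose a * ((a ^ (d + 2)) ^ a * (R ^ (d + 2)) ^ (L - a))) := by
      refine Finset.card_biUnion_le.trans (Finset.sum_le_sum fun a _ => ?_)
      refine (Finset.card_biUnion_le_card_mul _ _
        (R.choose a * ((a ^ (d + 2)) ^ a * (R ^ (d + 2)) ^ (L - a))) fun A hA => ?_).trans ?_
      · refine (Finset.card_biUnion_le_card_mul _ _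
          ((a ^ (d + 2)) ^ a * (R ^ (d + 2)) ^ (L - a)) fun B hB => ?_).trans ?_
        · rw [hTcard, (Finset.mem_powersetCard.1 hA).2, (Finset.mem_powersetCard.1 hB).2]
        · simp [hR]
      · simp [hL]
    exact_mod_cast this
  have hRpos : (0 : ℝ) < R := by exact_mod_cast hβ
  have hterm : ∀ a ∈ Finset.Icc 1 s,
      (L.choose a : ℝ) * (R.choose a * (((a : ℝ) ^ (d + 2)) ^ a * ((R : ℝ) ^ (d + 2)) ^ (L - a)))
        ≤ ((R : ℝ) ^ (d + 2)) ^ L * (1 / 2) ^ a := by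
    intro a ha
    obtain ⟨ha1, has⟩ := Finset.mem_Icc.1 ha
    have ha0 : (0 : ℝ) < a := by exact_mod_cast ha1
    rcases lt_or_ge L a with hLa | hLa
    · rw [Nat.choose_eq_zero_of_lt hLa]; simp
    -- From `a ^ a / a! ≤ e ^ a ≤ 3 ^ a`. The two binomial coefficients then contribute the 9 of
    -- `hq`, and the 18 of the hypothesis leaves the ratio `1 / 2`.
    have hfac : ∀ N : ℕ, (N.choose a : ℝ) ≤ (3 * N / a) ^ a := by
      intro N
      have h1 : (N.choose a : ℝ) ≤ N ^ a / a.factorial := Nat.choose_le_pow_div a N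
      have h2 : (a : ℝ) ^ a / a.factorial ≤ 3 ^ a := by
        calc (a : ℝ) ^ a / a.factorial ≤ Real.exp a := Real.pow_div_factorial_le_exp _ ha0.le _
          _ = Real.exp 1 ^ a := by rw [← Real.exp_nat_mul, mul_one]
          _ ≤ 3 ^ a := by
            gcongr
            exact (Real.exp_one_lt_d9.trans (by norm_num)).le
      have h3 : (0 : ℝ) < a.factorial := by exact_mod_cast a.factorial_pos
      rw [div_le_iff₀ h3] at h2
      refine h1.trans ?_
      rw [div_pow, mul_pow, div_le_div_iff₀ h3 (by positivity)]
      calc (N : ℝ) ^ a * a ^ a ≤ N ^ a * (3 ^ a * a.factorial) := by gcongr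
        _ = _ := by ring
    have hq : 9 * ((L : ℝ) / R) * ((a : ℝ) / R) ^ d ≤ 1 / 2 := by
      have : 9 * ((L : ℝ) / R) * ((a : ℝ) / R) ^ d ≤ 9 * ((L : ℝ) / R) * ((s : ℝ) / R) ^ d := by
        gcongr
      linarith
    calc (L.choose a : ℝ) * (R.choose a * (((a : ℝ) ^ (d + 2)) ^ a * ((R : ℝ) ^ (d + 2)) ^ (L - a)))
        ≤ (3 * L / a) ^ a * ((3 * R / a) ^ a *
          (((a : ℝ) ^ (d + 2)) ^ a * ((R : ℝ) ^ (d + 2)) ^ (L - a))) := by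
            gcongr <;> exact hfac _
      _ = ((R : ℝ) ^ (d + 2)) ^ L * (9 * ((L : ℝ) / R) * ((a : ℝ) / R) ^ d) ^ a := by
            have : ((R : ℝ) ^ (d + 2)) ^ L = ((R : ℝ) ^ (d + 2)) ^ (L - a) * ((R : ℝ) ^ (d + 2)) ^ a := by
              rw [← pow_add, Nat.sub_add_cancel hLa]
            rw [this]
            have : 9 * ((L : ℝ) / R) * ((a : ℝ) / R) ^ d * (R : ℝ) ^ (d + 2) =
              (3 * L / a) * ((3 * R / a) * (a : ℝ) ^ (d + 2)) := by
              rw [div_pow, pow_add (R : ℝ), pow_add (a : ℝ)]; field_simp; ring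
            rw [mul_assoc (((R : ℝ) ^ (d + 2)) ^ (L - a)), mul_comm (((R : ℝ) ^ (d + 2)) ^ a), ← mul_pow, this,
              mul_pow, mul_pow]
            ring
      _ ≤ _ := by gcongr
  have hgeom : ∑ a ∈ Finset.Icc 1 s, (1 / 2 : ℝ) ^ a < 1 := by
    have : ∀ s : ℕ, ∑ a ∈ Finset.Icc 1 s, (1 / 2 : ℝ) ^ a = 1 - (1 / 2) ^ s := by
      intro s
      induction s with
      | zero => simp
      | succ s ih => rw [Finset.sum_Icc_succ_top (by omega), ih]; ring
    rw [this]
    have : (0 : ℝ) < (1 / 2) ^ s := by positivity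
    linarith
  have hlt : (bad.card : ℝ) < (Fintype.card (α → Fin (d + 2) → β) : ℝ) := by
    have hcard : (Fintype.card (α → Fin (d + 2) → β) : ℝ) = ((R : ℝ) ^ (d + 2)) ^ L := by
      simp [hL, hR]
    rw [hcard]
    calc (bad.card : ℝ) ≤ _ := hbad
      _ ≤ ∑ a ∈ Finset.Icc 1 s, ((R : ℝ) ^ (d + 2)) ^ L * (1 / 2) ^ a := Finset.sum_le_sum hterm
      _ = ((R : ℝ) ^ (d + 2)) ^ L * ∑ a ∈ Finset.Icc 1 s, (1 / 2 : ℝ) ^ a := by rw [Finset.mul_sum]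
      _ < ((R : ℝ) ^ (d + 2)) ^ L * 1 := by gcongr
      _ = _ := mul_one _
  obtain ⟨f, hf⟩ : ∃ f, f ∉ bad := by
    by_contra! hall
    have : bad = Finset.univ := Finset.eq_univ_iff_forall.2 hall
    rw [this, Finset.card_univ] at hlt
    exact lt_irrefl _ hlt
  refine ⟨f, fun A hA => ?_⟩
  by_contra! hlt'
  apply hf
  -- The image has fewer than `|A|` elements; it is padded to exactly `|A|`, because only sets of
  -- equal size were counted.
  obtain ⟨B, hB1, hB2⟩ := Finset.exists_superset_card_eq hlt'.le (hA.trans hs)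
  simp only [bad, Finset.mem_biUnion, Finset.mem_powersetCard, Finset.mem_Icc]
  refine ⟨A.card, ⟨by omega, hA⟩, A, ⟨Finset.subset_univ _, rfl⟩, B, ⟨Finset.subset_univ _, hB2⟩, ?_⟩
  simp only [T, Fintype.mem_piFinset]
  intro a
  split_ifs with haA
  · rw [Fintype.mem_piFinset]
    intro j
    exact hB1 (Finset.mem_biUnion.2 ⟨a, haA, Finset.mem_image_of_mem _ (Finset.mem_univ j)⟩)
  · simp

/-- A bounded-degree bipartite graph between a set `X ∪ Y` of colours and `3 m` slots, such that
every `m`-subset of `X` together with `Y` is matched perfectly to the slots. -/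
theorem exists_robustly_matchable {C : Type*} [DecidableEq C] (m : ℕ) (hm : 100 ≤ m)
    (X Y : Finset C) (hXY : Disjoint X Y) (hX : X.card ≤ 2 * m) (hY : Y.card = 2 * m) :
    ∃ N : Fin (3 * m) → Finset C, (∀ z, N z ⊆ X ∪ Y) ∧ (∀ z, (N z).Nonempty) ∧
      ∑ z, (N z).card ≤ 70 * m ∧
      ∀ U ⊆ X, U.card = m → ∃ φ : Fin (3 * m) → C, Function.Injective φ ∧ (∀ z, φ z ∈ N z) ∧
        Finset.univ.image φ = U ∪ Y := by
  have hmr : (100 : ℝ) ≤ m := by exact_mod_cast hm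
  have hm0 : (0 : ℝ) < m := by linarith
  obtain ⟨f, hf⟩ := exists_expander (α := Fin (3 * m)) (β := Y) 12 (3 * m / 2)
    (by simp [hY]; omega) (by simp [hY]; omega) (by
      have h1 : ((3 * m / 2 : ℕ) : ℝ) ≤ 3 * m / 2 := by
        have := Nat.cast_div_le (α := ℝ) (m := 3 * m) (n := 2); push_cast at this; linarith
      simp only [Fintype.card_fin, Fintype.card_coe, hY]
      push_cast
      have h2 : ((3 * m / 2 : ℕ) : ℝ) / (2 * m) ≤ 3 / 4 := by
        rw [div_le_div_iff₀ (by positivity) (by norm_num)]; linarith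
      calc 18 * ((3 * m : ℝ) / (2 * m)) * (((3 * m / 2 : ℕ) : ℝ) / (2 * m)) ^ 12
          ≤ 18 * (3 / 2) * (3 / 4) ^ 12 := by
            gcongr 18 * ?_ * ?_ ^ 12
            rw [mul_div_mul_right _ _ hm0.ne']
        _ ≤ 1 := by norm_num)
  obtain ⟨g, hg⟩ := exists_expander (α := (X ∪ Y : Finset C)) (β := Fin (3 * m)) 5 ((3 * m + 1) / 2)
    (by simp; omega) (by simp; omega) (by
      have h1 : (((3 * m + 1) / 2 : ℕ) : ℝ) ≤ (3 * m + 1) / 2 := by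
        have := Nat.cast_div_le (α := ℝ) (m := 3 * m + 1) (n := 2); push_cast at this; linarith
      have h3 : ((X ∪ Y).card : ℝ) ≤ 4 * m := by
        have : (X ∪ Y).card ≤ 4 * m := (Finset.card_union_le _ _).trans (by omega)
        exact_mod_cast this
      simp only [Fintype.card_fin, Fintype.card_coe]
      push_cast
      have h2 : (((3 * m + 1) / 2 : ℕ) : ℝ) / (3 * m) ≤ 51 / 100 := by
        rw [div_le_div_iff₀ (by positivity) (by norm_num)]; linarith
      calc 18 * (((X ∪ Y).card : ℝ) / (3 * m)) * ((((3 * m + 1) / 2 : ℕ) : ℝ) / (3 * m)) ^ 5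
          ≤ 18 * (4 / 3) * (51 / 100) ^ 5 := by
            gcongr 18 * ?_ * ?_ ^ 5
            rw [div_le_div_iff₀ (by positivity) (by norm_num)]; linarith
        _ ≤ 1 := by norm_num)
  -- Two random graphs are superposed: `N₁` expands sets of at most half of the slots into `Y`, and
  -- `N₂` expands sets of about half as many colours as slots into the slots.
  let N₁ : Fin (3 * m) → Finset C := fun z => Finset.univ.image fun j => (f z j : C)
  let N₂ : Fin (3 * m) → Finset C := fun z =>
    (Finset.univ.filter fun c : (X ∪ Y : Finset C) => ∃ j, g c j = z).image Subtype.val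
  have hN₁ : ∀ z, (N₁ z).card ≤ 14 := fun z => Finset.card_image_le.trans (by simp)
  have hN₂ : ∑ z, (N₂ z).card ≤ 28 * m := by
    calc ∑ z, (N₂ z).card
        ≤ ∑ z, (Finset.univ.filter fun p : (X ∪ Y : Finset C) × Fin 7 => g p.1 p.2 = z).card := by
          refine Finset.sum_le_sum fun z _ => ?_
          have : N₂ z ⊆ (Finset.univ.filter fun p : (X ∪ Y : Finset C) × Fin 7 =>
              g p.1 p.2 = z).image fun p => (p.1 : C) := by
            intro c hc
            simp only [N₂, Finset.mem_image, Finset.mem_filter, Finset.mem_univ, true_and] at hc ⊢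
            obtain ⟨c', ⟨j, hj⟩, rfl⟩ := hc
            exact ⟨(c', j), hj, rfl⟩
          exact (Finset.card_le_card this).trans Finset.card_image_le
      _ = (Finset.univ : Finset ((X ∪ Y : Finset C) × Fin 7)).card :=
          (Finset.card_eq_sum_card_fiberwise (fun _ _ => Finset.mem_univ _)).symm
      _ ≤ 28 * m := by
          have : (X ∪ Y).card ≤ 4 * m := (Finset.card_union_le _ _).trans (by omega)
          simp only [Finset.card_univ, Fintype.card_prod, Fintype.card_coe, Fintype.card_fin]
          omega
  refine ⟨fun z => N₁ z ∪ N₂ z, ?_, ?_, ?_, ?_⟩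
  · intro z c hc
    simp only [N₁, N₂, Finset.mem_union, Finset.mem_image, Finset.mem_univ, true_and] at hc
    rcases hc with ⟨j, rfl⟩ | ⟨c', -, rfl⟩
    · exact Finset.mem_union_right _ (f z j).2
    · exact c'.2
  · intro z
    exact ⟨f z 0, Finset.mem_union_left _ (Finset.mem_image_of_mem _ (Finset.mem_univ _))⟩
  -- 14 edges at each of `3m` slots and 7 at each of at most `4m` colours.
  · calc ∑ z, (N₁ z ∪ N₂ z).card ≤ ∑ z, ((N₁ z).card + (N₂ z).card) :=
          Finset.sum_le_sum fun z _ => Finset.card_union_le _ _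
      _ ≤ ∑ _z : Fin (3 * m), 14 + 28 * m := by
          rw [Finset.sum_add_distrib]
          exact Nat.add_le_add (Finset.sum_le_sum fun z _ => hN₁ z) hN₂
      _ ≤ 70 * m := by simp; omega
  · intro U hU hUm
    have hUY : (U ∪ Y).card = 3 * m := by
      rw [Finset.card_union_of_disjoint (Finset.disjoint_of_subset_left hU hXY)]; omega
    have hall : ∀ A : Finset (Fin (3 * m)),
        A.card ≤ (A.biUnion fun z => (N₁ z ∪ N₂ z) ∩ (U ∪ Y)).card := by
      intro A
      rcases le_or_gt A.card (3 * m / 2) with hA | hA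
      · refine (hf A hA).trans ?_
        rw [← Finset.card_image_of_injective _ Subtype.val_injective]
        refine Finset.card_le_card fun c hc => ?_
        simp only [Finset.mem_image, Finset.mem_biUnion, Finset.mem_univ, true_and] at hc
        obtain ⟨y, ⟨z, hz, j, rfl⟩, rfl⟩ := hc
        refine Finset.mem_biUnion.2 ⟨z, hz, Finset.mem_inter.2 ⟨?_, Finset.mem_union_right _ (f z j).2⟩⟩
        exact Finset.mem_union_left _ (Finset.mem_image_of_mem _ (Finset.mem_univ _))
      -- For large `A`, Hall's condition is checked from the other side. If it fails, at least `3m -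
      -- |A| + 1` colours of `U ∪ Y` have no neighbour in `A`. By expansion they have at least that
      -- many neighbours, all in the complement of `A`, which is too small.
      · by_contra! hlt
        set Q := A.biUnion fun z => (N₁ z ∪ N₂ z) ∩ (U ∪ Y) with hQ
        have hQs : Q ⊆ U ∪ Y := Finset.biUnion_subset.2 fun z _ => Finset.inter_subset_right
        have hcard : ((U ∪ Y) \ Q).card = 3 * m - Q.card := by
          rw [Finset.card_sdiff_of_subset hQs, hUY]
        obtain ⟨B, hBs, hBc⟩ := Finset.exists_subset_card_eq
          (show 3 * m - A.card + 1 ≤ ((U ∪ Y) \ Q).card by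
            have := Finset.card_le_univ A
            simp at this
            omega)
        have hBXY : ∀ c ∈ B, c ∈ X ∪ Y := fun c hc => by
          have := (Finset.mem_sdiff.1 (hBs hc)).1
          exact Finset.union_subset_union_left hU this
        have hBc' : (B.subtype (· ∈ X ∪ Y)).card = B.card := by
          rw [Finset.card_subtype, Finset.filter_true_of_mem hBXY]
        have h1 := hg (B.subtype (· ∈ X ∪ Y)) (by omega)
        have h2 : ((B.subtype (· ∈ X ∪ Y)).biUnion fun a => Finset.univ.image (g a)) ⊆ Aᶜ := by
          intro z hz
          simp only [Finset.mem_biUnion, Finset.mem_image, Finset.mem_univ, true_and,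
            Finset.mem_subtype] at hz
          obtain ⟨c, hc, j, rfl⟩ := hz
          rw [Finset.mem_compl]
          intro hzA
          have hcs := Finset.mem_sdiff.1 (hBs hc)
          refine hcs.2 (Finset.mem_biUnion.2 ⟨_, hzA, Finset.mem_inter.2 ⟨?_, hcs.1⟩⟩)
          exact Finset.mem_union_right _ (Finset.mem_image.2 ⟨c, by simp, rfl⟩)
        have h3 := h1.trans (Finset.card_le_card h2)
        rw [Finset.card_compl, Fintype.card_fin] at h3
        omega
    obtain ⟨φ, hφ, hφm⟩ := (Finset.all_card_le_biUnion_card_iff_exists_injective _).1 hall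
    refine ⟨φ, hφ, fun z => (Finset.mem_inter.1 (hφm z)).1, ?_⟩
    apply Finset.eq_of_subset_of_card_le
    · intro c hc
      obtain ⟨z, -, rfl⟩ := Finset.mem_image.1 hc
      exact (Finset.mem_inter.1 (hφm z)).2
    · rw [Finset.card_image_of_injective _ hφ, hUY]; simp

/-! ### Trails as lists, and their translation to and from rainbow directed paths. -/

namespace ColoredDigraph

variable {V C : Type*}

/-- `D.Trail s w vs cs t`: the edges prescribed by the word `w` of directions lead from `s` to `t`
through the vertices `vs` (listed after `s`) and have the colours `cs`. -/
inductive Trail (D : ColoredDigraph V C) : V → List Dir → List V → List C → V → Prop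
  | nil (s : V) : Trail D s [] [] [] s
  | cons {d : Dir} {s u t : V} {c : C} {w : List Dir} {vs : List V} {cs : List C} :
      D.DArc d s u c → Trail D u w vs cs t → Trail D s (d :: w) (u :: vs) (c :: cs) t

namespace Trail

variable {D : ColoredDigraph V C} {s t u : V} {w w' : List Dir} {vs vs' : List V} {cs cs' : List C}

theorem append (h : D.Trail s w vs cs t) (h' : D.Trail t w' vs' cs' u) :
    D.Trail s (w ++ w') (vs ++ vs') (cs ++ cs') u := by
  induction h with
  | nil => exact h'
  | cons ha _ ih => exact .cons ha (ih h')

theorem length_verts (h : D.Trail s w vs cs t) : vs.length = w.length := by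
  induction h with
  | nil => rfl
  | cons _ _ ih => simp [ih]

theorem length_colors (h : D.Trail s w vs cs t) : cs.length = w.length := by
  induction h with
  | nil => rfl
  | cons _ _ ih => simp [ih]

theorem getLast_eq (h : D.Trail s w vs cs t) : (s :: vs).getLast (by simp) = t := by
  induction h with
  | nil => rfl
  | cons _ _ ih => simpa using ih

theorem mem_end (h : D.Trail s w vs cs t) : t ∈ s :: vs := by
  rw [← h.getLast_eq]; exact List.getLast_mem _

theorem dArc_getElem (h : D.Trail s w vs cs t) : ∀ (i : ℕ) (hi : i < w.length),
    D.DArc w[i] ((s :: vs)[i]'(by simp [h.length_verts]; omega))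
      ((s :: vs)[i + 1]'(by simp [h.length_verts]; omega)) (cs[i]'(by rw [h.length_colors]; omega)) := by
  induction h with
  | nil => intro i hi; simp at hi
  | cons ha _ ih =>
    intro i hi
    cases i with
    | zero => simpa using ha
    | succ i => simpa using ih i (by simpa using hi)

theorem of_getElem {D : ColoredDigraph V C} : ∀ (w : List Dir) (vs : List V) (cs : List C) (s : V)
    (hv : vs.length = w.length) (hc : cs.length = w.length),
    (∀ (i : ℕ) (hi : i < w.length), D.DArc w[i] ((s :: vs)[i]'(by simp; omega))
      ((s :: vs)[i + 1]'(by simp; omega)) (cs[i]'(by omega))) →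
    D.Trail s w vs cs ((s :: vs).getLast (by simp)) := by
  intro w
  induction w with
  | nil =>
    intro vs cs s hv hc _
    obtain rfl : vs = [] := by simpa using hv
    obtain rfl : cs = [] := by simpa using hc
    exact .nil s
  | cons d w ih =>
    intro vs cs s hv hc h
    cases vs with
    | nil => simp at hv
    | cons v vs =>
      cases cs with
      | nil => simp at hc
      | cons c cs =>
        rw [List.getLast_cons (by simp)]
        refine .cons (h 0 (by simp)) (ih vs cs v (by simpa using hv) (by simpa using hc) ?_)
        intro i hi
        exact h (i + 1) (by simpa using hi)

end Trail

/-- There is a trail from `s` to `t` along the word `w` whose vertices, other than `s`, are `W`,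
and whose colours are `K`, both counted with multiplicity. -/
def Realizes (D : ColoredDigraph V C) (w : List Dir) (s t : V) (W : Multiset V) (K : Multiset C) :
    Prop :=
  ∃ vs cs, D.Trail s w vs cs t ∧ (vs : Multiset V) = W ∧ (cs : Multiset C) = K

namespace Realizes

variable {D : ColoredDigraph V C} {s t u : V} {w w' : List Dir} {W W' : Multiset V}
  {K K' : Multiset C}

theorem append (h : D.Realizes w s t W K) (h' : D.Realizes w' t u W' K') :
    D.Realizes (w ++ w') s u (W + W') (K + K') := by
  obtain ⟨vs, cs, ht, rfl, rfl⟩ := h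
  obtain ⟨vs', cs', ht', rfl, rfl⟩ := h'
  exact ⟨_, _, ht.append ht', by simp, by simp⟩

theorem card_verts (h : D.Realizes w s t W K) : W.card = w.length := by
  obtain ⟨vs, cs, ht, rfl, rfl⟩ := h
  simpa using ht.length_verts

theorem card_colors (h : D.Realizes w s t W K) : K.card = w.length := by
  obtain ⟨vs, cs, ht, rfl, rfl⟩ := h
  simpa using ht.length_colors

theorem mem_end (h : D.Realizes w s t W K) : t ∈ s ::ₘ W := by
  obtain ⟨vs, cs, ht, rfl, rfl⟩ := h
  simpa using ht.mem_end

theorem of_dArc {d : Dir} {c : C} (h : D.DArc d s u c) : D.Realizes [d] s u {u} {c} :=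
  ⟨[u], [c], .cons h (.nil u), rfl, rfl⟩

end Realizes

theorem orient_eq_orient {d d' : Dir} {a b a' b' : V} (h : orient d a b = orient d' a' b') :
    (a = a' ∧ b = b') ∨ (a = b' ∧ b = a') := by
  cases d <;> cases d' <;> simp only [orient, Prod.mk.injEq] at h <;> tauto

/-- If the pairs agree only after swapping the endpoints, injectivity gives `i = j + 1` and `j = i +
1`, which is absurd. -/
theorem eq_of_orient_eq {k : ℕ} {p : Fin (k + 1) → V} (hp : Function.Injective p) {d d' : Dir}
    {i j : Fin k} (h : orient d (p i.castSucc) (p i.succ) = orient d' (p j.castSucc) (p j.succ)) :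
    i = j := by
  rcases orient_eq_orient h with ⟨h1, -⟩ | ⟨h1, h2⟩
  · exact Fin.castSucc_injective _ (hp h1)
  · have h1 := congrArg Fin.val (hp h1)
    have h2 := congrArg Fin.val (hp h2)
    simp at h1 h2
    omega

/-- A rainbow directed path in a subdigraph of `D` gives a trail in `D`. -/
theorem IsDirectedPath.realizes {D P : ColoredDigraph V C} {k : ℕ} {σ : Fin k → Dir} {s t : V}
    (hP : P.IsDirectedPath σ s t) (hr : P.IsRainbow) (hD : P.IsSubdigraph D) :
    ∃ (W : Multiset V) (K : Multiset C), D.Realizes (List.ofFn σ) s t W K ∧ (s ::ₘ W).Nodup ∧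
      K.Nodup ∧ (∀ v, v ∈ s ::ₘ W ↔ v ∈ P.verts) ∧ ∀ c, c ∈ K ↔ c ∈ P.colors := by
  obtain ⟨p, hp, hv, he, rfl, rfl⟩ := hP
  have hc : ∀ i : Fin k, ∃ c, P.DArc (σ i) (p i.castSucc) (p i.succ) c := by
    intro i
    have : orient (σ i) (p i.castSucc) (p i.succ) ∈ P.edges := by rw [he]; exact ⟨i, rfl⟩
    exact this
  choose c hc using hc
  have hcons : p 0 :: List.ofFn (fun i => p i.succ) = List.ofFn p := by rw [List.ofFn_succ]
  have hinj : Function.Injective c := by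
    intro i j hij
    have h1 := hc i
    have h2 := hc j
    rw [← hij] at h2
    obtain ⟨h3, h4⟩ := hr h1 h2
    exact eq_of_orient_eq hp (Prod.ext h3 h4)
  refine ⟨(List.ofFn (fun i => p i.succ) : List V), (List.ofFn c : List C),
    ⟨_, _, ?_, rfl, rfl⟩, ?_, ?_, ?_, ?_⟩
  · have := Trail.of_getElem (D := D) (List.ofFn σ) (List.ofFn (fun i => p i.succ)) (List.ofFn c) (p 0)
      (by simp) (by simp) (by
        intro i hi
        simp only [hcons, List.getElem_ofFn]
        exact hD.2 (hc ⟨i, by simpa using hi⟩))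
    convert this
    simp only [hcons]
    rw [List.getLast_eq_getElem]
    simp only [List.length_ofFn, add_tsub_cancel_right, List.getElem_ofFn]
    rfl
  · rw [Multiset.cons_coe, hcons, Multiset.coe_nodup]
    exact List.nodup_ofFn.2 hp
  · rw [Multiset.coe_nodup]
    exact List.nodup_ofFn.2 hinj
  · intro v
    rw [Multiset.cons_coe, hcons, Multiset.mem_coe, hv, List.mem_ofFn]
    rfl
  · intro a
    rw [Multiset.mem_coe, List.mem_ofFn]
    constructor
    · rintro ⟨i, rfl⟩
      exact ⟨_, _, hc i⟩
    · rintro ⟨u, v, huv⟩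
      have : (u, v) ∈ P.edges := ⟨a, huv⟩
      rw [he] at this
      obtain ⟨i, hi⟩ := this
      refine ⟨i, P.arc_unique (hc i) ?_⟩
      rw [← hi]
      exact huv

/-- A trail without repeated vertices and colours in `D` is a rainbow directed path in every
subdigraph of `D` that keeps all edges with the vertices and colours of the trail. -/
theorem Realizes.exists_path {D A : ColoredDigraph V C} {k : ℕ} {σ : Fin k → Dir} {s t : V}
    {W : Multiset V} {K : Multiset C} (h : D.Realizes (List.ofFn σ) s t W K)
    (hW : (s ::ₘ W).Nodup) (hK : K.Nodup) (hWA : ∀ v ∈ s ::ₘ W, v ∈ A.verts)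
    (hA : ∀ u v c, D.Arc u v c → u ∈ s ::ₘ W → v ∈ s ::ₘ W → c ∈ K → A.Arc u v c) :
    ∃ P : ColoredDigraph V C, P.IsSubdigraph A ∧ P.IsRainbow ∧ P.IsDirectedPath σ s t ∧
      P.verts = {v | v ∈ s ::ₘ W} ∧ P.colors = {c | c ∈ K} := by
  obtain ⟨vs, cs, ht, rfl, rfl⟩ := h
  have hlv : vs.length = k := by simpa using ht.length_verts
  have hlc : cs.length = k := by simpa using ht.length_colors
  rw [Multiset.cons_coe, Multiset.coe_nodup] at hW
  rw [Multiset.coe_nodup] at hK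
  let p : Fin (k + 1) → V := fun i => (s :: vs)[i.1]'(by simp; omega)
  let c : Fin k → C := fun i => cs[i.1]'(by omega)
  have hp : Function.Injective p := by
    intro i j hij
    exact Fin.ext ((List.Nodup.getElem_inj_iff hW).1 hij)
  have hci : Function.Injective c := by
    intro i j hij
    exact Fin.ext ((List.Nodup.getElem_inj_iff hK).1 hij)
  have hpm : ∀ v, (∃ i, p i = v) ↔ v ∈ s :: vs := by
    intro v
    constructor
    · rintro ⟨i, rfl⟩; exact List.getElem_mem _
    · intro hv
      obtain ⟨i, hi, rfl⟩ := List.getElem_of_mem hv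
      exact ⟨⟨i, by simp at hi; omega⟩, rfl⟩
  have hcm : ∀ a, (∃ i, c i = a) ↔ a ∈ cs := by
    intro v
    constructor
    · rintro ⟨i, rfl⟩; exact List.getElem_mem _
    · intro hv
      obtain ⟨i, hi, rfl⟩ := List.getElem_of_mem hv
      exact ⟨⟨i, by omega⟩, rfl⟩
  have harc : ∀ i, D.DArc (σ i) (p i.castSucc) (p i.succ) (c i) := by
    intro i
    have := ht.dArc_getElem i.1 (by simp)
    simpa [p, c] using this
  have horm : ∀ i, (orient (σ i) (p i.castSucc) (p i.succ)).1 ∈ s :: vs ∧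
      (orient (σ i) (p i.castSucc) (p i.succ)).2 ∈ s :: vs := by
    intro i
    have h1 := (hpm _).1 ⟨i.castSucc, rfl⟩
    have h2 := (hpm _).1 ⟨i.succ, rfl⟩
    cases σ i
    · exact ⟨h1, h2⟩
    · exact ⟨h2, h1⟩
  let P : ColoredDigraph V C :=
    { verts := {v | v ∈ s :: vs}
      Arc := fun u v a => ∃ i, (u, v) = orient (σ i) (p i.castSucc) (p i.succ) ∧ a = c i
      finite_verts := List.finite_toSet _
      arc_left_mem := by
        rintro u v a ⟨i, hi, -⟩
        have := (horm i).1
        rw [← hi] at this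
        exact this
      arc_right_mem := by
        rintro u v a ⟨i, hi, -⟩
        have := (horm i).2
        rw [← hi] at this
        exact this
      arc_ne := by
        rintro u v a ⟨i, hi, -⟩
        have := D.arc_ne (harc i)
        rw [← hi] at this
        exact this
      arc_unique := by
        rintro u v a a' ⟨i, hi, rfl⟩ ⟨j, hj, rfl⟩
        rw [hi] at hj
        rw [eq_of_orient_eq hp hj] }
  have hPcol : P.colors = {a | a ∈ cs} := by
    ext a
    constructor
    · rintro ⟨u, v, i, -, rfl⟩
      exact (hcm _).1 ⟨i, rfl⟩
    · intro ha
      obtain ⟨i, rfl⟩ := (hcm a).2 ha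
      exact ⟨_, _, i, rfl, rfl⟩
  refine ⟨P, ⟨fun v hv => hWA v hv, ?_⟩, ?_, ⟨p, hp, ?_, ?_, rfl, ?_⟩, ?_, ?_⟩
  · rintro u v a ⟨i, hi, rfl⟩
    have h1 := harc i
    have h2 := horm i
    unfold DArc at h1
    rw [← hi] at h1 h2
    exact hA _ _ _ h1 (by simpa using h2.1) (by simpa using h2.2)
      (by simpa using (hcm _).1 ⟨i, rfl⟩)
  · rintro u v u' v' a ⟨i, hi, rfl⟩ ⟨j, hj, hij⟩
    rw [← hci hij] at hj
    rw [← hi] at hj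
    exact ⟨congrArg Prod.fst hj.symm, congrArg Prod.snd hj.symm⟩
  · ext v; exact (hpm v).symm
  · ext ⟨u, v⟩
    constructor
    · rintro ⟨a, i, hi, -⟩; exact ⟨i, hi⟩
    · rintro ⟨i, hi⟩; exact ⟨_, i, hi, rfl⟩
  · rw [← ht.getLast_eq, List.getLast_eq_getElem]
    simp [p, hlv]
  · simp [P]
  · simpa using hPcol

end ColoredDigraph

/-! ### Reservoirs, and the greedy joining of flexible pieces. -/

namespace ColoredDigraph

variable {V C : Type*}

/-- `Vf` and `Cf` are sets of vertices and colours of `D`, each of size at least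
`D.verts.ncard + ℓ - M`. -/
structure IsRoomy (D : ColoredDigraph V C) (M ℓ : ℕ) (Vf : Finset V) (Cf : Finset C) : Prop where
  verts_subset : ∀ v ∈ Vf, v ∈ D.verts
  colors_subset : ∀ c ∈ Cf, c ∈ D.colors
  card_verts : D.verts.ncard + ℓ ≤ Vf.card + M
  card_colors : D.verts.ncard + ℓ ≤ Cf.card + M

theorem IsRoomy.shrink [DecidableEq V] [DecidableEq C] {D : ColoredDigraph V C} {M ℓ ℓ' : ℕ}
    {Vf : Finset V} {Cf : Finset C} (h : D.IsRoomy M ℓ Vf Cf) (W : Multiset V) (K : Multiset C)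
    (hW : W.card + ℓ' ≤ ℓ) (hK : K.card + ℓ' ≤ ℓ) :
    D.IsRoomy M ℓ' (Vf \ W.toFinset) (Cf \ K.toFinset) where
  verts_subset v hv := h.verts_subset v (Finset.mem_sdiff.1 hv).1
  colors_subset c hc := h.colors_subset c (Finset.mem_sdiff.1 hc).1
  card_verts := by
    have h1 := h.card_verts
    have h2 := Finset.le_card_sdiff W.toFinset Vf
    have h3 := W.toFinset_card_le
    omega
  card_colors := by
    have h1 := h.card_colors
    have h2 := Finset.le_card_sdiff K.toFinset Cf
    have h3 := K.toFinset_card_le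
    omega

theorem IsRoomy.mono {D : ColoredDigraph V C} {M ℓ ℓ' : ℕ} {Vf : Finset V} {Cf : Finset C}
    (h : D.IsRoomy M ℓ Vf Cf) (hℓ : ℓ' ≤ ℓ) : D.IsRoomy M ℓ' Vf Cf :=
  ⟨h.verts_subset, h.colors_subset, by have := h.card_verts; omega, by have := h.card_colors; omega⟩

/-- Any two vertices are joined by rainbow paths of length three inside any large reservoir. -/
def Connects (D : ColoredDigraph V C) (M : ℕ) : Prop :=
  ∀ Vf Cf, D.IsRoomy M 0 Vf Cf → ∀ s ∈ D.verts, ∀ t ∈ D.verts, s ∉ Vf → t ∉ Vf →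
    ∀ d₁ d₂ d₃ : Dir, ∃ u ∈ Vf, ∃ v ∈ Vf, u ≠ v ∧ ∃ c₁ ∈ Cf, ∃ c₂ ∈ Cf, ∃ c₃ ∈ Cf,
      c₁ ≠ c₂ ∧ c₁ ≠ c₃ ∧ c₂ ≠ c₃ ∧ D.DArc d₁ s u c₁ ∧ D.DArc d₂ u v c₂ ∧ D.DArc d₃ v t c₃

/-- Every vertex can be left in every direction inside any large reservoir. -/
def Extends (D : ColoredDigraph V C) (M : ℕ) : Prop :=
  ∀ Vf Cf, D.IsRoomy M 0 Vf Cf → ∀ s ∈ D.verts, ∀ d : Dir, ∃ u ∈ Vf, ∃ c ∈ Cf, D.DArc d s u c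

/-- For every `E ∈ ℰ` there is a trail along `w` from `s` to `t` with vertices `s` and `W` and
colours `I` and `E`; here `s`, `W` are distinct vertices in `Vf` and `I` distinct colours in `Cf`. -/
structure Piece (D : ColoredDigraph V C) (w : List Dir) (Vf : Finset V) (Cf : Finset C)
    (ℰ : Set (Multiset C)) (s t : V) (W : Multiset V) (I : Multiset C) : Prop where
  start_mem : s ∈ Vf
  nodup : (s ::ₘ W).Nodup
  verts_mem : ∀ v ∈ W, v ∈ Vf
  end_mem : t ∈ s ::ₘ W
  colors_nodup : I.Nodup
  colors_mem : ∀ c ∈ I, c ∈ Cf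
  card_verts : W.card ≤ w.length
  card_colors : I.card ≤ w.length
  realizes : ∀ E ∈ ℰ, D.Realizes w s t W (I + E)

/-- Every reservoir with enough room for twice the length of `w` contains a piece along `w` for the collection `ℰ`. -/
def Flexible (D : ColoredDigraph V C) (M : ℕ) (w : List Dir) (ℰ : Set (Multiset C)) : Prop :=
  ∀ Vf Cf, D.IsRoomy M (2 * w.length + 10) Vf Cf → ∃ s t W I, D.Piece w Vf Cf ℰ s t W I

theorem Piece.mono {D : ColoredDigraph V C} {w : List Dir} {Vf Vf' : Finset V} {Cf Cf' : Finset C}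
    {ℰ ℰ' : Set (Multiset C)} {s t : V} {W : Multiset V} {I : Multiset C}
    (h : D.Piece w Vf Cf ℰ s t W I) (hV : Vf ⊆ Vf') (hC : Cf ⊆ Cf') (hE : ℰ' ⊆ ℰ) :
    D.Piece w Vf' Cf' ℰ' s t W I :=
  { h with
    start_mem := hV h.start_mem
    verts_mem := fun v hv => hV (h.verts_mem v hv)
    colors_mem := fun c hc => hC (h.colors_mem c hc)
    realizes := fun E hE' => h.realizes E (hE hE') }

theorem Piece.mem_of_mem_cons {D : ColoredDigraph V C} {w : List Dir} {Vf : Finset V}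
    {Cf : Finset C} {ℰ : Set (Multiset C)} {s t : V} {W : Multiset V} {I : Multiset C}
    (h : D.Piece w Vf Cf ℰ s t W I) : ∀ v ∈ s ::ₘ W, v ∈ Vf := by
  intro v hv
  rcases Multiset.mem_cons.1 hv with rfl | hv
  · exact h.start_mem
  · exact h.verts_mem v hv

/-- Colours used by all trails of a piece become internal. -/
theorem Piece.absorb {D : ColoredDigraph V C} {w : List Dir} {Vf : Finset V} {Cf Cf' : Finset C}
    {ℰ ℰ' : Set (Multiset C)} {s t : V} {W : Multiset V} {I N : Multiset C}
    (h : D.Piece w Vf Cf ℰ s t W I) (hC : Cf ⊆ Cf') (hN : N.Nodup) (hNC : ∀ c ∈ N, c ∈ Cf')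
    (hNd : ∀ c ∈ N, c ∉ Cf) (hne : ℰ'.Nonempty) (hE : ∀ E ∈ ℰ', N + E ∈ ℰ) :
    D.Piece w Vf Cf' ℰ' s t W (I + N) :=
  { h with
    colors_nodup := Multiset.nodup_add.2 ⟨h.colors_nodup, hN,
      Multiset.disjoint_left.2 fun hc hc' => hNd _ hc' (h.colors_mem _ hc)⟩
    colors_mem := by
      intro c hc
      rcases Multiset.mem_add.1 hc with hc | hc
      · exact hC (h.colors_mem c hc)
      · exact hNC c hc
    card_colors := by
      obtain ⟨E, hE'⟩ := hne
      have := (h.realizes _ (hE E hE')).card_colors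
      simp only [Multiset.card_add] at this ⊢
      omega
    realizes := by
      intro E hE'
      rw [add_assoc]
      exact h.realizes _ (hE E hE') }

/-- Two disjoint pieces are joined by a path of length three. -/
theorem Piece.join [DecidableEq V] [DecidableEq C] {D : ColoredDigraph V C} {M : ℕ}
    (hD : D.Connects M) {w₁ w₂ : List Dir}
    {Vf : Finset V} {Cf : Finset C} {ℰ₁ ℰ₂ : Set (Multiset C)} {s₁ t₁ s₂ t₂ : V}
    {W₁ W₂ : Multiset V} {I₁ I₂ : Multiset C} (hroom : D.IsRoomy M (w₁.length + w₂.length + 2) Vf Cf)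
    (h₁ : D.Piece w₁ Vf Cf ℰ₁ s₁ t₁ W₁ I₁)
    (h₂ : D.Piece w₂ (Vf \ (s₁ ::ₘ W₁).toFinset) (Cf \ I₁.toFinset) ℰ₂ s₂ t₂ W₂ I₂)
    (d₁ d₂ d₃ : Dir) :
    ∃ W I, D.Piece (w₁ ++ d₁ :: d₂ :: d₃ :: w₂) Vf Cf
      {E | ∃ E₁ ∈ ℰ₁, ∃ E₂ ∈ ℰ₂, E = E₁ + E₂} s₁ t₂ W I := by
  have hs2 := Finset.mem_sdiff.1 h₂.start_mem
  have hW2 : ∀ v ∈ s₂ ::ₘ W₂, v ∈ Vf ∧ v ∉ s₁ ::ₘ W₁ := by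
    intro v hv
    have := Finset.mem_sdiff.1 (h₂.mem_of_mem_cons v hv)
    exact ⟨this.1, fun h => this.2 (Multiset.mem_toFinset.2 h)⟩
  have hI2 : ∀ c ∈ I₂, c ∈ Cf ∧ c ∉ I₁ := by
    intro c hc
    have := Finset.mem_sdiff.1 (h₂.colors_mem c hc)
    exact ⟨this.1, fun h => this.2 (Multiset.mem_toFinset.2 h)⟩
  have hcW1 := h₁.card_verts
  have hcW2 := h₂.card_verts
  have hcI1 := h₁.card_colors
  have hcI2 := h₂.card_colors
  have hr := hroom.shrink (ℓ' := 0) ((s₁ ::ₘ W₁) + (s₂ ::ₘ W₂)) (I₁ + I₂)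
    (by simp; omega) (by simp; omega)
  obtain ⟨u, hu, v, hv, huv, c₁, hc1, c₂, hc2, c₃, hc3, h12, h13, h23, ha1, ha2, ha3⟩ :=
    hD _ _ hr t₁ (hroom.verts_subset _ (h₁.mem_of_mem_cons _ h₁.end_mem)) s₂
      (hroom.verts_subset _ hs2.1)
      (fun h => (Finset.mem_sdiff.1 h).2
        (Multiset.mem_toFinset.2 (Multiset.mem_add.2 (Or.inl h₁.end_mem)))) (by simp) d₁ d₂ d₃
  simp only [Finset.mem_sdiff, Multiset.mem_toFinset, Multiset.mem_add, not_or] at hu hv hc1 hc2 hc3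
  refine ⟨W₁ + (u ::ₘ v ::ₘ s₂ ::ₘ W₂), I₁ + (c₁ ::ₘ c₂ ::ₘ c₃ ::ₘ I₂), ?_⟩
  have hreal : D.Realizes [d₁, d₂, d₃] t₁ s₂ {u, v, s₂} {c₁, c₂, c₃} :=
    ⟨[u, v, s₂], [c₁, c₂, c₃], .cons ha1 (.cons ha2 (.cons ha3 (.nil _))), rfl, rfl⟩
  refine ⟨h₁.start_mem, ?_, ?_, ?_, ?_, ?_, ?_, ?_, ?_⟩
  · rw [← Multiset.cons_add, Multiset.nodup_add]
    refine ⟨h₁.nodup, ?_, ?_⟩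
    · rw [Multiset.nodup_cons, Multiset.nodup_cons, Multiset.mem_cons, not_or]
      exact ⟨⟨huv, hu.2.2⟩, hv.2.2, h₂.nodup⟩
    · rw [Multiset.disjoint_right]
      intro a ha
      rw [Multiset.mem_cons, Multiset.mem_cons] at ha
      rcases ha with rfl | rfl | ha
      · exact hu.2.1
      · exact hv.2.1
      · exact (hW2 a ha).2
  · intro a ha
    rw [Multiset.mem_add, Multiset.mem_cons, Multiset.mem_cons] at ha
    rcases ha with ha | rfl | rfl | ha
    · exact h₁.verts_mem a ha
    · exact hu.1
    · exact hv.1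
    · exact (hW2 a ha).1
  · have := h₂.end_mem
    simp only [Multiset.mem_cons, Multiset.mem_add] at this ⊢
    tauto
  · rw [Multiset.nodup_add]
    refine ⟨h₁.colors_nodup, ?_, ?_⟩
    · simp only [Multiset.nodup_cons, Multiset.mem_cons, not_or]
      exact ⟨⟨h12, h13, hc1.2.2⟩, ⟨h23, hc2.2.2⟩, hc3.2.2, h₂.colors_nodup⟩
    · rw [Multiset.disjoint_right]
      intro a ha
      simp only [Multiset.mem_cons] at ha
      rcases ha with rfl | rfl | rfl | ha
      · exact hc1.2.1
      · exact hc2.2.1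
      · exact hc3.2.1
      · exact (hI2 a ha).2
  · intro a ha
    simp only [Multiset.mem_add, Multiset.mem_cons] at ha
    rcases ha with ha | rfl | rfl | rfl | ha
    · exact h₁.colors_mem a ha
    · exact hc1.1
    · exact hc2.1
    · exact hc3.1
    · exact (hI2 a ha).1
  · simp; omega
  · simp; omega
  · rintro _ ⟨E₁, hE1, E₂, hE2, rfl⟩
    have := (h₁.realizes E₁ hE1).append (hreal.append (h₂.realizes E₂ hE2))
    convert this using 1
    · simp
    · simp
    · simp only [Multiset.insert_eq_cons, ← Multiset.singleton_add]
      abel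

/-- The room required is one less than flexibility of the joined word would grant, so a single
colour may be reserved before joining. -/
theorem Flexible.exists_join {D : ColoredDigraph V C} {M : ℕ} (hD : D.Connects M)
    {w₁ w₂ : List Dir} {ℰ₁ ℰ₂ : Set (Multiset C)} (h₁ : D.Flexible M w₁ ℰ₁)
    (h₂ : D.Flexible M w₂ ℰ₂) (d₁ d₂ d₃ : Dir) {Vf : Finset V} {Cf : Finset C}
    (hroom : D.IsRoomy M (2 * (w₁ ++ d₁ :: d₂ :: d₃ :: w₂).length + 9) Vf Cf) :
    ∃ s t W I, D.Piece (w₁ ++ d₁ :: d₂ :: d₃ :: w₂) Vf Cf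
      {E | ∃ E₁ ∈ ℰ₁, ∃ E₂ ∈ ℰ₂, E = E₁ + E₂} s t W I := by
  classical
  simp only [List.length_append, List.length_cons] at hroom
  obtain ⟨s₁, t₁, W₁, I₁, hp1⟩ := h₁ Vf Cf (hroom.mono (by omega))
  have hcW1 := hp1.card_verts
  have hcI1 := hp1.card_colors
  obtain ⟨s₂, t₂, W₂, I₂, hp2⟩ := h₂ _ _ (hroom.shrink (ℓ' := 2 * w₂.length + 10) (s₁ ::ₘ W₁) I₁
    (by simp; omega) (by omega))
  obtain ⟨W, I, h⟩ := hp1.join hD (hroom.mono (by omega)) hp2 d₁ d₂ d₃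
  exact ⟨_, _, _, _, h⟩

theorem Flexible.join {D : ColoredDigraph V C} {M : ℕ} (hD : D.Connects M) {w₁ w₂ : List Dir}
    {ℰ₁ ℰ₂ : Set (Multiset C)} (h₁ : D.Flexible M w₁ ℰ₁) (h₂ : D.Flexible M w₂ ℰ₂)
    (d₁ d₂ d₃ : Dir) : D.Flexible M (w₁ ++ d₁ :: d₂ :: d₃ :: w₂)
      {E | ∃ E₁ ∈ ℰ₁, ∃ E₂ ∈ ℰ₂, E = E₁ + E₂} :=
  fun _ _ hroom => h₁.exists_join hD h₂ d₁ d₂ d₃ (hroom.mono (Nat.le_succ _))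

theorem Flexible.mono {D : ColoredDigraph V C} {M : ℕ} {w : List Dir} {ℰ ℰ' : Set (Multiset C)}
    (h : D.Flexible M w ℰ) (hE : ℰ' ⊆ ℰ) : D.Flexible M w ℰ' := by
  intro Vf Cf hroom
  obtain ⟨s, t, W, I, hp⟩ := h Vf Cf hroom
  exact ⟨s, t, W, I, hp.mono subset_rfl subset_rfl hE⟩

theorem Flexible.concat {D : ColoredDigraph V C} {M : ℕ} (hD : D.Extends M) {w : List Dir}
    {ℰ : Set (Multiset C)} (h : D.Flexible M w ℰ) (d : Dir) : D.Flexible M (w ++ [d]) ℰ := by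
  classical
  intro Vf Cf hroom
  simp only [List.length_append, List.length_cons, List.length_nil] at hroom
  obtain ⟨s, t, W, I, hp⟩ := h Vf Cf (hroom.mono (by omega))
  have hcW := hp.card_verts
  have hcI := hp.card_colors
  obtain ⟨u, hu, c, hc, ha⟩ := hD _ _ (hroom.shrink (ℓ' := 0) (s ::ₘ W) I (by simp; omega) (by omega)) t
    (hroom.verts_subset _ (hp.mem_of_mem_cons _ hp.end_mem)) d
  simp only [Finset.mem_sdiff, Multiset.mem_toFinset] at hu hc
  refine ⟨s, u, W + {u}, I + {c}, hp.start_mem, ?_, ?_, ?_, ?_, ?_, ?_, ?_, ?_⟩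
  · rw [← Multiset.cons_add, Multiset.nodup_add]
    exact ⟨hp.nodup, by simp, by simpa using hu.2⟩
  · intro v hv
    rcases Multiset.mem_add.1 hv with hv | hv
    · exact hp.verts_mem v hv
    · rw [Multiset.mem_singleton.1 hv]; exact hu.1
  · simp
  · rw [Multiset.nodup_add]
    exact ⟨hp.colors_nodup, by simp, by simpa using hc.2⟩
  · intro v hv
    rcases Multiset.mem_add.1 hv with hv | hv
    · exact hp.colors_mem v hv
    · rw [Multiset.mem_singleton.1 hv]; exact hc.1
  · simpa using hcW
  · simpa using hcI
  · intro E hE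
    have := (hp.realizes E hE).append (.of_dArc ha)
    rwa [add_right_comm] at this

theorem Flexible.append {D : ColoredDigraph V C} {M : ℕ} (hD : D.Extends M) {ℰ : Set (Multiset C)}
    (w' : List Dir) : ∀ {w : List Dir}, D.Flexible M w ℰ → D.Flexible M (w ++ w') ℰ := by
  induction w' with
  | nil => intro w h; simpa using h
  | cons d w' ih =>
    intro w h
    have := ih (h.concat hD d)
    simpa using this

/-- `D` is flexible for `ℰ` along all words of length at least `ℓ`. -/
def FlexibleFrom (D : ColoredDigraph V C) (M ℓ : ℕ) (ℰ : Set (Multiset C)) : Prop :=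
  ∀ w : List Dir, ℓ ≤ w.length → D.Flexible M w ℰ

/-- A piece on the first `ℓ` letters is prolonged edge by edge inside the reservoir; the extra
vertices and colours are internal. -/
theorem FlexibleFrom.of_eq {D : ColoredDigraph V C} {M ℓ : ℕ} (hD : D.Extends M)
    {ℰ : Set (Multiset C)} (h : ∀ w : List Dir, w.length = ℓ → D.Flexible M w ℰ) :
    D.FlexibleFrom M ℓ ℰ := by
  intro w hw
  have := (h (w.take ℓ) (by simp [hw])).append hD (w.drop ℓ)
  rwa [List.take_append_drop] at this

theorem FlexibleFrom.mono {D : ColoredDigraph V C} {M ℓ ℓ' : ℕ} {ℰ ℰ' : Set (Multiset C)}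
    (h : D.FlexibleFrom M ℓ ℰ) (hℓ : ℓ ≤ ℓ') (hE : ℰ' ⊆ ℰ) : D.FlexibleFrom M ℓ' ℰ' :=
  fun w hw => (h w (hℓ.trans hw)).mono hE

theorem exists_split (w : List Dir) (a : ℕ) (h : a + 3 ≤ w.length) : ∃ w₁ d₁ d₂ d₃ w₂,
    w = w₁ ++ d₁ :: d₂ :: d₃ :: w₂ ∧ w₁.length = a ∧ w₂.length = w.length - a - 3 := by
  refine ⟨w.take a, w[a], w[a + 1], w[a + 2], w.drop (a + 3), ?_, by simp; omega, by simp; omega⟩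
  rw [← List.drop_eq_getElem_cons, ← List.drop_eq_getElem_cons, ← List.drop_eq_getElem_cons,
    List.take_append_drop]

theorem FlexibleFrom.join {D : ColoredDigraph V C} {M ℓ₁ ℓ₂ : ℕ} (hD : D.Connects M)
    {ℰ₁ ℰ₂ : Set (Multiset C)} (h₁ : D.FlexibleFrom M ℓ₁ ℰ₁) (h₂ : D.FlexibleFrom M ℓ₂ ℰ₂) :
    D.FlexibleFrom M (ℓ₁ + 3 + ℓ₂) {E | ∃ E₁ ∈ ℰ₁, ∃ E₂ ∈ ℰ₂, E = E₁ + E₂} := by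
  intro w hw
  obtain ⟨w₁, d₁, d₂, d₃, w₂, rfl, hw1, hw2⟩ := exists_split w ℓ₁ (by omega)
  exact (h₁ w₁ hw1.ge).join hD (h₂ w₂ (by omega)) _ _ _

/-- The collection of the singletons `{c}` with `c ∈ S`. -/
def singletons (S : Finset C) : Set (Multiset C) := {E | ∃ c ∈ S, E = {c}}

/-- If every `S ∈ L` can be handled in length `f S`, then one element of every `S ∈ L` can be chosen
simultaneously, in a total length of `∑ (f S + 3) - 3`. -/
theorem FlexibleFrom.list {D : ColoredDigraph V C} {M : ℕ} (hD : D.Connects M) (f : Finset C → ℕ) :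
    ∀ L : List (Finset C), L ≠ [] → (∀ S ∈ L, D.FlexibleFrom M (f S) (singletons S)) →
      D.FlexibleFrom M ((L.map fun S => f S + 3).sum - 3)
        {E | ∃ l : List C, List.Forall₂ (fun c S => c ∈ S) l L ∧ E = l} := by
  intro L
  induction L with
  | nil => intro h; exact absurd rfl h
  | cons S L ih =>
    intro _ h
    have hS := h S (by simp)
    rcases eq_or_ne L [] with rfl | hL
    · refine hS.mono (by simp) ?_
      rintro _ ⟨l, hl, rfl⟩
      obtain ⟨c, l', hc, hl', rfl⟩ := List.forall₂_cons_right_iff.1 hl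
      obtain rfl := List.forall₂_nil_right_iff.1 hl'
      exact ⟨c, hc, rfl⟩
    · refine (hS.join hD (ih hL fun S hS => h S (List.mem_cons_of_mem _ hS))).mono ?_ ?_
      · obtain ⟨S', L', rfl⟩ := List.exists_cons_of_ne_nil hL
        simp
        omega
      · rintro _ ⟨l, hl, rfl⟩
        obtain ⟨c, l', hc, hl', rfl⟩ := List.forall₂_cons_right_iff.1 hl
        exact ⟨{c}, ⟨c, hc, rfl⟩, l', ⟨l', hl', rfl⟩, by simp⟩

end ColoredDigraph

/-! ### From two-way choices to choices among any number of colours. -/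

namespace ColoredDigraph

variable {V C : Type*}

/-- Every two colours can be exchanged along any word of length seven. -/
def HasWires (D : ColoredDigraph V C) (M : ℕ) : Prop :=
  ∀ a ∈ D.colors, ∀ b ∈ D.colors, ∀ w : List Dir, w.length = 7 →
    D.Flexible M w {E | E = {a} ∨ E = {b}}

/-- Along any word of length twelve there are three trails on the same vertices whose colours, apart
from common ones, are three six-element sets in the same position to each other as the edge sets
of the matchings `id`, `(0 1)`, `(0 2)` of `K₃,₃`, all edges doubled. -/
def HasSlots (D : ColoredDigraph V C) (M : ℕ) : Prop :=
  ∀ Vf Cf, D.IsRoomy M 40 Vf Cf → ∀ w : List Dir, w.length = 12 →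
    ∃ e : Fin 14 → C, Function.Injective e ∧ (∀ i, e i ∈ Cf) ∧ ∃ s t W I,
      D.Piece w Vf Cf
        {E | E = {e 0, e 1, e 2, e 3, e 4, e 5} ∨ E = {e 6, e 7, e 10, e 11, e 4, e 5} ∨
          E = {e 8, e 9, e 2, e 3, e 12, e 13}} s t W I ∧ ∀ c ∈ I, ∀ i, c ≠ e i

/-- One of three colours can be absorbed. -/
theorem flexibleFrom_three {D : ColoredDigraph V C} {M : ℕ} (hC : D.Connects M) (hX : D.Extends M)
    (hW : D.HasWires M) (hS : D.HasSlots M) {a b c : C} (ha : a ∈ D.colors) (hb : b ∈ D.colors)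
    (hc : c ∈ D.colors) : D.FlexibleFrom M 102 {E | E = {a} ∨ E = {b} ∨ E = {c}} := by
  classical
  intro w hw Vf Cf hroom
  obtain ⟨w₁, d₁, d₂, d₃, w₂, rfl, hw1, hw2⟩ := exists_split w 12 (by omega)
  simp only [List.length_append, List.length_cons] at hw hw2 hroom
  obtain ⟨e, he, heC, s₁, t₁, W₁, I₁, hp1, hI1⟩ := hS Vf Cf (hroom.mono (by omega)) w₁ hw1
  have heD : ∀ i, e i ∈ D.colors := fun i => hroom.colors_subset _ (heC i)
  let N : Multiset C := (List.ofFn e : List C)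
  have hN : ∀ x, x ∈ N ↔ ∃ i, e i = x := by
    intro x
    rw [Multiset.mem_coe, List.mem_ofFn]
  have hNcard : N.card = 14 := by simp [N]
  -- The switch has no internal colour among the `e i`, so these can be withheld from the reservoir
  -- now and declared internal at the end.
  have hp1' : D.Piece w₁ Vf (Cf \ N.toFinset) _ s₁ t₁ W₁ I₁ :=
    { hp1 with
      colors_mem := fun x hx => Finset.mem_sdiff.2 ⟨hp1.colors_mem x hx, fun hx' => by
        obtain ⟨i, rfl⟩ := (hN x).1 (Multiset.mem_toFinset.1 hx')
        exact hI1 _ hx i rfl⟩ }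
  have hcW1 := hp1.card_verts
  have hcI1 := hp1.card_colors
  -- Whichever six colours the switch uses, these nine two-way choices can pick the eight remaining
  -- `e i` together with one of `a`, `b`, `c`. Every mode therefore uses all 14 colours `e i` and
  -- exactly one target. The length is `12 + 3 + (9 * 10 - 3) = 102`.
  let L : List (Finset C) := [{e 6, e 2}, {e 7, e 3}, {e 8, e 4}, {e 9, e 5}, {e 11, e 1},
    {e 13, e 1}, {e 10, b}, {e 12, c}, {e 0, a}]
  have hpair : ∀ x ∈ D.colors, ∀ y ∈ D.colors, D.FlexibleFrom M 7 (singletons {x, y}) := by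
    intro x hx y hy
    refine (FlexibleFrom.of_eq hX (hW x hx y hy)).mono le_rfl ?_
    rintro _ ⟨z, hz, rfl⟩
    rcases Finset.mem_insert.1 hz with rfl | hz
    · exact Or.inl rfl
    · rw [Finset.mem_singleton.1 hz]; exact Or.inr rfl
  have hL := FlexibleFrom.list hC (fun _ => 7) L (by simp [L]) (by
    intro S hS
    simp only [L, List.mem_cons, List.not_mem_nil, or_false] at hS
    rcases hS with rfl | rfl | rfl | rfl | rfl | rfl | rfl | rfl | rfl <;>
    exact hpair _ (heD _) _ (by first | exact heD _ | assumption))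
  have hroom' : D.IsRoomy M (2 * w₁.length + 2 * w₂.length) Vf (Cf \ N.toFinset) := by
    have := hroom.shrink (ℓ' := 2 * w₁.length + 2 * w₂.length) 0 N (by simp; omega) (by omega)
    simpa using this
  obtain ⟨s₂, t₂, W₂, I₂, hp2⟩ := hL w₂ (by simp [L]; omega) _ _ (hroom'.shrink
    (ℓ' := 2 * w₂.length + 10) (s₁ ::ₘ W₁) I₁ (by simp; omega) (by omega))
  obtain ⟨W, I, hp⟩ := hp1'.join hC (hroom'.mono (by omega)) hp2 d₁ d₂ d₃
  refine ⟨s₁, t₂, W, I + N, hp.absorb Finset.sdiff_subset ?_ ?_ ?_ ⟨{a}, Or.inl rfl⟩ ?_⟩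
  · exact Multiset.coe_nodup.2 (List.nodup_ofFn.2 he)
  · intro x hx
    obtain ⟨i, rfl⟩ := (hN x).1 hx
    exact heC i
  · intro x hx hx'
    exact (Finset.mem_sdiff.1 hx').2 (Multiset.mem_toFinset.2 hx)
  · have hNe : N = {e 0} + ({e 1} + ({e 2} + ({e 3} + ({e 4} + ({e 5} + ({e 6} + ({e 7} +
        ({e 8} + ({e 9} + ({e 10} + ({e 11} + ({e 12} + {e 13})))))))))))) := by
      simp only [N, List.ofFn_succ, List.ofFn_zero, ← Multiset.cons_coe, ← Multiset.singleton_add,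
        Multiset.coe_nil, add_zero]
      rfl
    rintro E (rfl | rfl | rfl)
    · refine ⟨_, Or.inl rfl, _, ⟨[e 6, e 7, e 8, e 9, e 11, e 13, e 10, e 12, a], by simp [L], rfl⟩, ?_⟩
      simp only [hNe, Multiset.insert_eq_cons, ← Multiset.cons_coe, ← Multiset.singleton_add,
        Multiset.coe_nil, add_zero]
      abel
    · refine ⟨_, Or.inr (Or.inl rfl), _,
        ⟨[e 2, e 3, e 8, e 9, e 1, e 13, b, e 12, e 0], by simp [L], rfl⟩, ?_⟩
      simp only [hNe, Multiset.insert_eq_cons, ← Multiset.cons_coe, ← Multiset.singleton_add,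
        Multiset.coe_nil, add_zero]
      abel
    · refine ⟨_, Or.inr (Or.inr rfl), _,
        ⟨[e 6, e 7, e 4, e 5, e 11, e 1, e 10, c, e 0], by simp [L], rfl⟩, ?_⟩
      simp only [hNe, Multiset.insert_eq_cons, ← Multiset.cons_coe, ← Multiset.singleton_add,
        Multiset.coe_nil, add_zero]
      abel

/-- One of `d` colours can be absorbed in length `105 d - 3`. -/
theorem flexibleFrom_singletons {D : ColoredDigraph V C} {M : ℕ} (hC : D.Connects M)
    (hX : D.Extends M) (hW : D.HasWires M) (hS : D.HasSlots M) : ∀ (k : ℕ) (S : Finset C),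
    S.card = k + 1 → (∀ c ∈ S, c ∈ D.colors) → M ≤ D.verts.ncard →
      D.FlexibleFrom M (105 * (k + 1) - 3) (singletons S) := by
  classical
  intro k
  induction k with
  | zero =>
    intro S hSc hSD _
    obtain ⟨a, rfl⟩ := Finset.card_eq_one.1 hSc
    -- A wire whose two colours are both `a`, padded from length 7 to 102.
    refine (FlexibleFrom.of_eq hX (hW a (hSD a (by simp)) a (hSD a (by simp)))).mono (by norm_num) ?_
    rintro _ ⟨c, hc, rfl⟩
    rw [Finset.mem_singleton.1 hc]
    exact Or.inl rfl
  | succ k ih =>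
    intro S hSc hSD hM w hw Vf Cf hroom
    obtain ⟨a, S', ha, rfl, hS'c⟩ := Finset.card_eq_succ.1 hSc
    obtain ⟨b, T, hb, rfl, hTc⟩ := Finset.card_eq_succ.1 hS'c
    -- The auxiliary colour: one piece chooses from `insert q T`, the other from `a`, `b`, `q`. The
    -- piece that does not take the target takes `q`. It only has to avoid `T`, so that the
    -- induction applies to a set of `k + 1` colours.
    obtain ⟨q, hq⟩ : ∃ q, q ∈ Cf \ T := by
      rw [← Finset.Nonempty, ← Finset.card_pos]
      have h1 := Finset.le_card_sdiff T Cf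
      have h2 := hroom.card_colors
      omega
    obtain ⟨hqC, hqT⟩ := Finset.mem_sdiff.1 hq
    have hqD := hroom.colors_subset q hqC
    have h1 := ih (insert q T) (by rw [Finset.card_insert_of_notMem hqT, hTc]) (by
      intro c hc
      rcases Finset.mem_insert.1 hc with rfl | hc
      · exact hqD
      · exact hSD c (by simp [hc])) hM
    have h2 := flexibleFrom_three hC hX hW hS (hSD a (by simp)) (hSD b (by simp)) hqD
    obtain ⟨w₁, d₁, d₂, d₃, w₂, rfl, hw1, hw2⟩ := exists_split w (105 * (k + 1) - 3) (by omega)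
    have hroom' : D.IsRoomy M (2 * (w₁ ++ d₁ :: d₂ :: d₃ :: w₂).length + 9) Vf (Cf \ {q}) := by
      simpa using hroom.shrink (ℓ' := 2 * (w₁ ++ d₁ :: d₂ :: d₃ :: w₂).length + 9) 0 {q}
        (by rw [Multiset.card_zero]; omega) (by rw [Multiset.card_singleton]; omega)
    obtain ⟨s, t, W, I, hp⟩ := (h1 w₁ hw1.ge).exists_join hC (h2 w₂ (by omega)) d₁ d₂ d₃ hroom'
    refine ⟨s, t, W, I + {q}, hp.absorb Finset.sdiff_subset (by simp) (by simpa using hqC) (by simp)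
      ⟨{a}, a, by simp, rfl⟩ ?_⟩
    rintro _ ⟨c, hc, rfl⟩
    simp only [Finset.mem_insert] at hc
    rcases hc with rfl | rfl | hc
    · exact ⟨{q}, ⟨q, by simp, rfl⟩, {c}, Or.inl rfl, rfl⟩
    · exact ⟨{q}, ⟨q, by simp, rfl⟩, {c}, Or.inr (Or.inl rfl), rfl⟩
    · exact ⟨{c}, ⟨c, by simp [hc], rfl⟩, {q}, Or.inr (Or.inr rfl), add_comm _ _⟩

end ColoredDigraph

/-! ### Connections, extensions and wires from pseudorandomness. -/

/-- The opposite direction. -/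
def Dir.flip : Dir → Dir
  | .fwd => .bwd
  | .bwd => .fwd

namespace ColoredDigraph

variable {V C : Type*}

namespace DArc

variable {D : ColoredDigraph V C} {d : Dir} {u v v' : V} {c c' : C}

theorem symm (h : D.DArc d u v c) : D.DArc d.flip v u c := by
  cases d <;> exact h

theorem symm' (h : D.DArc d.flip u v c) : D.DArc d v u c := by
  cases d <;> exact h

theorem left_mem (h : D.DArc d u v c) : u ∈ D.verts := by
  cases d
  · exact D.arc_left_mem h
  · exact D.arc_right_mem h

theorem right_mem (h : D.DArc d u v c) : v ∈ D.verts := h.symm.left_mem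

theorem color_mem (h : D.DArc d u v c) : c ∈ D.colors := ⟨_, _, h⟩

theorem ne (h : D.DArc d u v c) : u ≠ v := by
  cases d
  · exact D.arc_ne h
  · exact (D.arc_ne h).symm

theorem unique (h : D.DArc d u v c) (h' : D.DArc d u v c') : c = c' := D.arc_unique h h'

end DArc

/-- Representatives of the neighbours of a vertex, one for each of the given colours. -/
theorem IsRoomy.exists_representatives [DecidableEq V] {D : ColoredDigraph V C} {M : ℕ}
    {Vf : Finset V} {Cf : Finset C} (hroom : D.IsRoomy M 0 Vf Cf) {v : V} {d : Dir} {K : Finset C}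
    (hne : K.Nonempty) (hK : ∀ c ∈ K, c ∈ D.colorsAt d v) :
    ∃ B ⊆ Vf, K.card ≤ B.card + M ∧ ∃ κ : V → C, (∀ u ∈ B, κ u ∈ K ∧ D.DArc d v u (κ u)) ∧
      Set.InjOn κ B := by
  obtain ⟨c₀, hc₀⟩ := hne
  obtain ⟨v₀, -⟩ := hK c₀ hc₀
  have : Nonempty C := ⟨c₀⟩
  have : Nonempty V := ⟨v₀⟩
  classical
  choose! g hg using hK
  -- An edge has only one colour, so different colours have different representatives, and at most
  -- `M` of these fall outside `Vf`.
  have hinj : Set.InjOn g K := by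
    intro c hc c' hc' hcc
    have h1 := hg c hc
    rw [hcc] at h1
    exact h1.unique (hg c' hc')
  have h1 : (K.image g).card ≤ (K.image g ∩ Vf).card + M := by
    have hsub : (Vf : Set V) ⊆ D.verts := fun c hc => hroom.verts_subset c hc
    have h2 := Set.ncard_sdiff_add_ncard_of_subset hsub D.finite_verts
    have h3 := hroom.card_verts
    have h4 : (K.image g \ Vf).card ≤ (D.verts \ Vf).ncard := by
      rw [← Set.ncard_coe_finset]
      refine Set.ncard_le_ncard ?_ D.finite_verts.sdiff
      intro u hu
      simp only [Finset.coe_sdiff, Finset.coe_image, Set.mem_sdiff, Set.mem_image, Finset.mem_coe] at hu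
      obtain ⟨⟨c, hc, rfl⟩, hu⟩ := hu
      exact ⟨(hg c hc).right_mem, hu⟩
    rw [Set.ncard_coe_finset] at h2
    have h5 := Finset.card_inter_add_card_sdiff (K.image g) Vf
    omega
  rw [Finset.card_image_of_injOn hinj] at h1
  have hκ : ∀ u ∈ K.image g ∩ Vf, ∃ c, c ∈ K ∧ D.DArc d v u c ∧ g c = u := by
    intro u hu
    obtain ⟨c, hc, rfl⟩ := Finset.mem_image.1 (Finset.mem_inter.1 hu).1
    exact ⟨c, hc, hg c hc, rfl⟩
  choose! κ hκ1 hκ2 hκ3 using hκ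
  refine ⟨K.image g ∩ Vf, Finset.inter_subset_right, h1, κ, fun u hu => ⟨hκ1 u hu, hκ2 u hu⟩, ?_⟩
  intro u hu u' hu' huu
  rw [← hκ3 u hu, ← hκ3 u' hu', huu]

namespace IsEdgeColorPseudorandom

variable {D : ColoredDigraph V C} {n M : ℕ} {α ε : ℝ}

theorem finite_colors (h : D.IsEdgeColorPseudorandom n α ε) (hn : 0 < n) : D.colors.Finite :=
  Set.finite_of_ncard_pos (by rw [h.card_colors]; exact hn)

theorem card_colorsAt_inter [DecidableEq C] (h : D.IsEdgeColorPseudorandom n α ε) (hn : 0 < n)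
    {Vf : Finset V} {Cf : Finset C} (hroom : D.IsRoomy M 0 Vf Cf) {v : V} (hv : v ∈ D.verts)
    (d : Dir) : ∃ K ⊆ Cf, (∀ c ∈ K, c ∈ D.colorsAt d v) ∧ α * n / 2 - M ≤ (K.card : ℝ) := by
  classical
  refine ⟨Cf.filter (· ∈ D.colorsAt d v), Finset.filter_subset _ _,
    fun c hc => (Finset.mem_filter.1 hc).2, ?_⟩
  have hfin := h.finite_colors hn
  have hsub : (Cf : Set C) ⊆ D.colors := fun c hc => hroom.colors_subset c hc
  have h1 : (D.colorsAt d v).ncard ≤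
      ((Cf.filter (· ∈ D.colorsAt d v) : Finset C) : Set C).ncard + (D.colors \ Cf).ncard := by
    refine (Set.ncard_le_ncard ?_ ((Finset.finite_toSet _).union hfin.sdiff)).trans (Set.ncard_union_le _ _)
    intro c hc
    by_cases hcf : c ∈ Cf
    · exact Or.inl (by simp [hcf, hc])
    · obtain ⟨u, hu⟩ := hc
      exact Or.inr ⟨hu.color_mem, hcf⟩
  have h2 := Set.ncard_sdiff_add_ncard_of_subset hsub hfin
  rw [Set.ncard_coe_finset, h.card_colors] at h2
  rw [Set.ncard_coe_finset] at h1
  have h3 := hroom.card_colors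
  rw [h.card_verts] at h3
  have h4 : ((D.colorsAt d v).ncard : ℝ) ≤ (Cf.filter (· ∈ D.colorsAt d v)).card + M := by
    exact_mod_cast (by omega : (D.colorsAt d v).ncard ≤ (Cf.filter (· ∈ D.colorsAt d v)).card + M)
  have h5 := h.color_diversity v hv d
  linarith

/-- Disjoint sets of `⌈α n / 8⌉` colours at two given vertices. -/
theorem exists_disjoint_colors [DecidableEq C] (h : D.IsEdgeColorPseudorandom n α ε) (hn : 0 < n)
    (hα : 100 ≤ α * n) (hM : (M : ℝ) ≤ α * n / 50)
    {Vf : Finset V} {Cf : Finset C} (hroom : D.IsRoomy M 0 Vf Cf) {s t : V} (hs : s ∈ D.verts)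
    (ht : t ∈ D.verts) (d d' : Dir) : ∃ K ⊆ Cf, ∃ K' ⊆ Cf, Disjoint K K' ∧
      (∀ c ∈ K, c ∈ D.colorsAt d s) ∧ (∀ c ∈ K', c ∈ D.colorsAt d' t) ∧
      K.card = ⌈α * n / 8⌉₊ ∧ K'.card = ⌈α * n / 8⌉₊ := by
  obtain ⟨K₁, hK1, hK1', hc1⟩ := h.card_colorsAt_inter hn hroom hs d
  obtain ⟨K₂, hK2, hK2', hc2⟩ := h.card_colorsAt_inter hn hroom ht d'
  have hceil : (⌈α * n / 8⌉₊ : ℝ) < α * n / 8 + 1 := Nat.ceil_lt_add_one (by linarith)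
  obtain ⟨K, hK, hKc⟩ := Finset.exists_subset_card_eq (show ⌈α * n / 8⌉₊ ≤ K₁.card by
    have : (⌈α * n / 8⌉₊ : ℝ) ≤ K₁.card := by linarith
    exact_mod_cast this)
  obtain ⟨K', hK', hKc'⟩ := Finset.exists_subset_card_eq (show ⌈α * n / 8⌉₊ ≤ (K₂ \ K).card by
    have h1 : (K₂.card : ℝ) ≤ (K₂ \ K).card + K.card := by
      exact_mod_cast (by have := Finset.le_card_sdiff K K₂; omega : K₂.card ≤ (K₂ \ K).card + K.card)
    rw [hKc] at h1
    have : (⌈α * n / 8⌉₊ : ℝ) ≤ (K₂ \ K).card := by linarith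
    exact_mod_cast this)
  exact ⟨K, hK.trans hK1, K', (hK'.trans Finset.sdiff_subset).trans hK2,
    (Finset.disjoint_of_subset_left hK' Finset.sdiff_disjoint).symm,
    fun c hc => hK1' c (hK hc), fun c hc => hK2' c (Finset.mem_sdiff.1 (hK' hc)).1, hKc, hKc'⟩

/-- Reserve disjoint colour sets `K` at `s` and `K'` at `t`. Their representatives form two large
vertex sets, and pseudorandomness supplies an edge between these in a colour outside `K ∪ K'`; the
three colours are then distinct. -/
theorem connects (h : D.IsEdgeColorPseudorandom n α ε) (hn : 0 < n) (hα1 : α ≤ 1)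
    (hα : 100 ≤ α * n) (hε : ε ≤ α / 50) (hM : (M : ℝ) ≤ α * n / 50) : D.Connects M := by
  classical
  intro Vf Cf hroom s hs t ht hsV htV d₁ d₂ d₃
  obtain ⟨K, hK, K', hK', hdisj, hKs, hKt, hKc, hKc'⟩ :=
    h.exists_disjoint_colors hn hα hM hroom hs ht d₁ d₃.flip
  have hpos : 0 < ⌈α * n / 8⌉₊ := Nat.ceil_pos.2 (by linarith)
  obtain ⟨B, hB, hBc, κ, hκ, -⟩ :=
    hroom.exists_representatives (Finset.card_pos.1 (hKc ▸ hpos)) hKs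
  obtain ⟨B', hB', hBc', κ', hκ', -⟩ :=
    hroom.exists_representatives (Finset.card_pos.1 (hKc' ▸ hpos)) hKt
  have hceil : (⌈α * n / 8⌉₊ : ℝ) < α * n / 8 + 1 := Nat.ceil_lt_add_one (by linarith)
  have hceil' : α * n / 8 ≤ (⌈α * n / 8⌉₊ : ℝ) := Nat.le_ceil _
  have hαn : α * n ≤ n := mul_le_of_le_one_left (Nat.cast_nonneg n) hα1
  have hεn : ε * n ≤ α * n / 50 := by
    have := mul_le_mul_of_nonneg_right hε (Nat.cast_nonneg (α := ℝ) n)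
    linarith
  have hBr : (⌈α * n / 8⌉₊ : ℝ) ≤ B.card + M := by rw [← hKc]; exact_mod_cast hBc
  have hBr' : (⌈α * n / 8⌉₊ : ℝ) ≤ B'.card + M := by rw [← hKc']; exact_mod_cast hBc'
  have hroomC := hroom.card_colors
  rw [h.card_verts] at hroomC
  have hQ : (n : ℝ) ≤ (Cf \ (K ∪ K')).card + (⌈α * n / 8⌉₊ + ⌈α * n / 8⌉₊) + M := by
    have h1 := Finset.le_card_sdiff (K ∪ K') Cf
    have h2 := Finset.card_union_le K K'
    rw [hKc, hKc'] at h2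
    exact_mod_cast (by omega :
      n ≤ (Cf \ (K ∪ K')).card + (⌈α * n / 8⌉₊ + ⌈α * n / 8⌉₊) + M)
  obtain ⟨u, hu, w, hw, c, hc, ha⟩ := h.exists_edge B B'
    (fun v hv => hroom.verts_subset v (hB hv)) (fun v hv => hroom.verts_subset v (hB' hv))
    (Cf \ (K ∪ K') : Finset C) (fun c hc => hroom.colors_subset c (Finset.mem_sdiff.1 hc).1)
    (by rw [Set.ncard_coe_finset]; linarith) (by rw [Set.ncard_coe_finset]; linarith)
    (by rw [Set.ncard_coe_finset]; linarith) d₂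
  have hc' := Finset.mem_sdiff.1 hc
  have h1 := hκ u hu
  have h2 := hκ' w hw
  refine ⟨u, hB hu, w, hB' hw, ha.ne, κ u, hK h1.1, c, hc'.1, κ' w, hK' h2.1, ?_, ?_, ?_,
    h1.2, ha, h2.2.symm'⟩
  · rintro rfl
    exact hc'.2 (Finset.mem_union_left _ h1.1)
  · intro heq
    exact Finset.disjoint_left.1 hdisj h1.1 (heq ▸ h2.1)
  · rintro rfl
    exact hc'.2 (Finset.mem_union_right _ h2.1)

theorem exits (h : D.IsEdgeColorPseudorandom n α ε) (hn : 0 < n)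
    (hα : 100 ≤ α * n) (hM : (M : ℝ) ≤ α * n / 50) : D.Extends M := by
  classical
  intro Vf Cf hroom s hs d
  obtain ⟨K, hK, hK', hc⟩ := h.card_colorsAt_inter hn hroom hs d
  obtain ⟨B, hB, hBc, κ, hκ, -⟩ := hroom.exists_representatives (Finset.card_pos.1 (by
    have : (0 : ℝ) < K.card := by linarith
    exact_mod_cast this)) hK'
  have hBr : (K.card : ℝ) ≤ B.card + M := by exact_mod_cast hBc
  have hpos : 0 < B.card := by
    have : (0 : ℝ) < B.card := by linarith
    exact_mod_cast this
  obtain ⟨u, hu⟩ := Finset.card_pos.1 hpos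
  exact ⟨u, hB hu, κ u, hK (hκ u hu).1, (hκ u hu).2⟩

end IsEdgeColorPseudorandom

theorem vertexPart_colorPair (a b : C) :
    vertexPart (⋃₀ (colorPair a b : Set (Set (V ⊕ C)))) = ∅ := by
  ext v
  simp [vertexPart, colorPair]

theorem colorPart_colorPair (a b : C) :
    colorPart (⋃₀ (colorPair a b : Set (Set (V ⊕ C)))) = {a, b} := by
  ext c
  simp [colorPart, colorPair, or_comm]

/-- The sets absorbed contain no vertices, so every vertex of the gadget is internal and both of its
paths have the same vertex set. Their colour sets differ only in `a` and `b`. -/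
theorem IsColorGadgetPseudorandom.hasWires {D : ColoredDigraph V C} {ν : ℝ} {M : ℕ}
    (h : D.IsColorGadgetPseudorandom ν) (hM : (M : ℝ) ≤ ν * D.verts.ncard) : D.HasWires M := by
  classical
  intro a ha b hb w hw Vf Cf hroom
  have hV : ((1 - ν) * D.verts.ncard : ℝ) ≤ Vf.card := by
    have : (D.verts.ncard : ℝ) ≤ Vf.card + M := by
      exact_mod_cast (by have := hroom.card_verts; omega : D.verts.ncard ≤ Vf.card + M)
    linarith
  have hC : ((1 - ν) * D.verts.ncard : ℝ) ≤ Cf.card := by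
    have : (D.verts.ncard : ℝ) ≤ Cf.card + M := by
      exact_mod_cast (by have := hroom.card_colors; omega : D.verts.ncard ≤ Cf.card + M)
    linarith
  obtain ⟨σ, rfl⟩ : ∃ σ : Fin 7 → Dir, w = List.ofFn σ := by
    exact ⟨fun i => w[i.1]'(by omega), List.ext_getElem (by rw [List.length_ofFn]; exact hw) (by
      intro i h1 h2; rw [List.getElem_ofFn])⟩
  obtain ⟨A, s, t, hAD, ⟨-, hs, ht, hA⟩, hAV, hAC⟩ := h Vf Cf (fun v hv => hroom.verts_subset v hv)
    (fun c hc => hroom.colors_subset c hc) (by rwa [Set.ncard_coe_finset])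
    (by rwa [Set.ncard_coe_finset]) a ha b hb σ
  have hIV : A.internalVerts (colorPair a b) = A.verts := by
    rw [internalVerts, vertexPart_colorPair, Set.sdiff_empty]
  have key : ∀ c, c = a ∨ c = b → ∃ W K, D.Realizes (List.ofFn σ) s t W K ∧ (s ::ₘ W).Nodup ∧
      K.Nodup ∧ (∀ v, v ∈ s ::ₘ W ↔ v ∈ A.verts) ∧
      ∀ x, x ∈ K ↔ x ∈ A.internalColors (colorPair a b) ∨ x = c := by
    intro c hc
    obtain ⟨P, hPA, hr, hP, hPv, hPc⟩ := hA {Sum.inr c} (by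
      rcases hc with rfl | rfl
      · exact Or.inl rfl
      · exact Or.inr rfl)
    obtain ⟨W, K, h1, h2, h3, h4, h5⟩ := hP.realizes (D := D) hr
      ⟨hPA.1.trans hAD.1, fun u v c h => hAD.2 (hPA.2 h)⟩
    refine ⟨W, K, h1, h2, h3, fun v => ?_, fun x => ?_⟩
    · rw [h4, hPv, hIV]
      simp [vertexPart]
    · rw [h5, hPc]
      simp [colorPart, or_comm]
  have hnot : ∀ c, c = a ∨ c = b → c ∉ A.internalColors (colorPair a b) := by
    intro c hc h
    rw [internalColors, colorPart_colorPair] at h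
    exact h.2 hc
  obtain ⟨W, K, h1, h2, h3, h4, h5⟩ := key a (Or.inl rfl)
  have hKI : ∀ x, x ∈ K.erase a ↔ x ∈ A.internalColors (colorPair a b) := by
    intro x
    rw [h3.mem_erase_iff, h5]
    constructor
    · rintro ⟨hx, hx' | hx'⟩
      · exact hx'
      · exact absurd hx' hx
    · intro hx
      exact ⟨fun hxa => hnot a (Or.inl rfl) (hxa ▸ hx), Or.inl hx⟩
  -- Deleting `a` from the colours of the path for `a` leaves exactly the internal colours.
  refine ⟨s, t, W, K.erase a, ?_, h2, ?_, h1.mem_end, h3.erase a, ?_, h1.card_verts.le, ?_, ?_⟩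
  · exact hAV (by rwa [hIV])
  · intro v hv
    exact hAV (by rw [hIV, ← h4]; exact Multiset.mem_cons_of_mem hv)
  · intro x hx
    exact hAC ((hKI x).1 hx)
  · rw [← h1.card_colors]
    exact Multiset.card_le_card (Multiset.erase_le _ _)
  · intro E hE
    obtain ⟨c, hc, rfl⟩ : ∃ c, (c = a ∨ c = b) ∧ E = {c} := by
      rcases hE with rfl | rfl
      · exact ⟨a, Or.inl rfl, rfl⟩
      · exact ⟨b, Or.inr rfl, rfl⟩
    obtain ⟨W', K', h1', h2', h3', h4', h5'⟩ := key c hc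
    have hW : W' = W := by
      have : s ::ₘ W' = s ::ₘ W :=
        (Multiset.Nodup.ext h2' h2).2 fun v => (h4' v).trans (h4 v).symm
      exact (Multiset.cons_inj_right s).1 this
    have hKK : K' = K.erase a + {c} := by
      refine (Multiset.Nodup.ext h3' ?_).2 fun x => ?_
      · rw [Multiset.nodup_add]
        exact ⟨h3.erase a, by simp, by
          simpa [Multiset.disjoint_right] using fun hx => hnot c hc ((hKI c).1 hx)⟩
      · rw [h5', Multiset.mem_add, hKI, Multiset.mem_singleton]
    rw [← hW, ← hKK]
    exact h1'

end ColoredDigraph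

/-! ### A rainbow `K₃,₆` by repeated averaging. -/

/-- If every `x ∈ X` has `γ R` elements outside `P` in its set `B x` of elements of `S`, where
`|S| ≤ R`, then some element of `S` outside `P` belongs to `B x` for `γ |X|` of the `x ∈ X`. -/
theorem exists_popular {α β : Type*} [DecidableEq β] (X : Finset α) (hX : X.Nonempty)
    (S P : Finset β) (B : α → Finset β) (γ R : ℝ) (hγ : 0 < γ) (hR : 0 < R) (hS : (S.card : ℝ) ≤ R)
    (hB : ∀ x ∈ X, B x ⊆ S) (hBc : ∀ x ∈ X, γ * R ≤ (B x \ P).card) :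
    ∃ h ∈ S, h ∉ P ∧ γ * X.card ≤ ((X.filter fun x => h ∈ B x).card : ℝ) := by
  have hsum : ∑ h ∈ S \ P, (X.filter fun x => h ∈ B x).card = ∑ x ∈ X, (B x \ P).card := by
    refine (Finset.sum_card_bipartiteAbove_eq_sum_card_bipartiteBelow (s := X) (t := S \ P)
      fun x h => h ∈ B x).symm.trans (Finset.sum_congr rfl fun x hx => ?_)
    congr 1
    ext h
    simp only [Finset.bipartiteAbove, Finset.mem_filter, Finset.mem_sdiff]
    exact ⟨fun h => ⟨h.2, h.1.2⟩, fun h => ⟨⟨hB x hx h.1, h.2⟩, h.1⟩⟩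
  have hne : (S \ P).Nonempty := by
    obtain ⟨x, hx⟩ := hX
    have : 0 < (B x \ P).card := by
      have : (0 : ℝ) < (B x \ P).card := lt_of_lt_of_le (by positivity) (hBc x hx)
      exact_mod_cast this
    obtain ⟨h, hh⟩ := Finset.card_pos.1 this
    exact ⟨h, Finset.sdiff_subset_sdiff (hB x hx) subset_rfl hh⟩
  obtain ⟨h, hh, hle⟩ := Finset.exists_le_of_sum_le (s := S \ P) (f := fun _ => γ * X.card)
    (g := fun h => ((X.filter fun x => h ∈ B x).card : ℝ)) hne (by
      rw [Finset.sum_const, nsmul_eq_mul]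
      have h1 : ((S \ P).card : ℝ) ≤ R :=
        le_trans (by exact_mod_cast Finset.card_le_card Finset.sdiff_subset) hS
      calc ((S \ P).card : ℝ) * (γ * X.card) ≤ R * (γ * X.card) := by gcongr
        _ = ∑ _x ∈ X, γ * R := by rw [Finset.sum_const, nsmul_eq_mul]; ring
        _ ≤ ∑ x ∈ X, ((B x \ P).card : ℝ) := Finset.sum_le_sum hBc
        _ = _ := by exact_mod_cast hsum.symm)
  exact ⟨h, (Finset.mem_sdiff.1 hh).1, (Finset.mem_sdiff.1 hh).2, hle⟩

/-- Averaging is repeated `b` times, keeping a proportion `γ` of `X` each time. `P` collects the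
elements already chosen, and the summand `a` in the lower bound pays for excluding them. -/
theorem exists_popular_fin {α β ι : Type*} [DecidableEq β] (S : Finset β) (B : ι → α → Finset β)
    (γ R : ℝ) (hγ : 0 < γ) (hR : 0 < R) (hS : (S.card : ℝ) ≤ R) (a : ℕ) : ∀ (b : ℕ) (d : Fin b → ι)
    (X : Finset α) (P : Finset β), X.Nonempty → P.card + b ≤ a → (∀ i, ∀ x ∈ X, B i x ⊆ S) →
    (∀ i, ∀ x ∈ X, γ * R + a ≤ (B i x).card) →
    ∃ h : Fin b → β, Function.Injective h ∧ (∀ q, h q ∈ S ∧ h q ∉ P) ∧ ∃ X' ⊆ X,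
      γ ^ b * X.card ≤ (X'.card : ℝ) ∧ ∀ x ∈ X', ∀ q, h q ∈ B (d q) x := by
  intro b
  induction b with
  | zero =>
    intro d X P _ _ _ _
    exact ⟨Fin.elim0, fun i => i.elim0, fun i => i.elim0, X, subset_rfl, by simp, fun x _ i => i.elim0⟩
  | succ b ih =>
    intro d X P hX hP hB hBc
    obtain ⟨h₀, hh₀, hh₀P, hcard⟩ := exists_popular X hX S P (B (d 0)) γ R hγ hR hS (hB _) (by
      intro x hx
      have h1 := hBc (d 0) x hx
      have h2 : ((B (d 0) x).card : ℝ) ≤ (B (d 0) x \ P).card + a := by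
        exact_mod_cast (by have := Finset.le_card_sdiff P (B (d 0) x); omega :
          (B (d 0) x).card ≤ (B (d 0) x \ P).card + a)
      linarith)
    set X₁ := X.filter fun x => h₀ ∈ B (d 0) x with hX1
    have hX1ne : X₁.Nonempty := by
      rw [← Finset.card_pos]
      have h1 : (0 : ℝ) < X.card := by exact_mod_cast Finset.card_pos.2 hX
      have : (0 : ℝ) < X₁.card := lt_of_lt_of_le (by positivity) hcard
      exact_mod_cast this
    have hX1s : X₁ ⊆ X := Finset.filter_subset _ _
    obtain ⟨h, hinj, hh, X', hX', hc', hX'B⟩ := ih (fun q => d q.succ) X₁ (insert h₀ P) hX1ne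
      (by have := Finset.card_insert_le h₀ P; omega) (fun i x hx => hB i x (hX1s hx))
      (fun i x hx => hBc i x (hX1s hx))
    refine ⟨Fin.cons h₀ h, ?_, ?_, X', hX'.trans hX1s, ?_, ?_⟩
    · rw [Fin.cons_injective_iff]
      refine ⟨?_, hinj⟩
      rintro ⟨q, rfl⟩
      exact (hh q).2 (Finset.mem_insert_self _ _)
    · intro q
      refine Fin.cases ⟨hh₀, hh₀P⟩ (fun q => ?_) q
      exact ⟨(hh q).1, fun hq => (hh q).2 (Finset.mem_insert_of_mem hq)⟩
    · calc γ ^ (b + 1) * X.card = γ ^ b * (γ * X.card) := by ring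
        _ ≤ γ ^ b * X₁.card := by gcongr
        _ ≤ _ := hc'
    · intro x hx q
      refine Fin.cases (Finset.mem_filter.1 (hX' hx)).2 (fun q => ?_) q
      exact hX'B x hx q

namespace ColoredDigraph

variable {V C : Type*}

/-- A rainbow copy of `K₃,₆`, oriented as prescribed, inside a large reservoir. -/
theorem IsEdgeColorPseudorandom.exists_rainbow_biclique {D : ColoredDigraph V C} {n M : ℕ} {α ε : ℝ}
    (h : D.IsEdgeColorPseudorandom n α ε) (hα0 : 0 < α) (hn : 0 < n) (hα1 : α ≤ 1)
    (hα : 1000 ≤ α * n) (hM : (M : ℝ) ≤ α * n / 50)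
    (hlog : 72 * (n / Real.log n) < (α / 20) ^ 6 * (n / 2))
    {Vf : Finset V} {Cf : Finset C} (hroom : D.IsRoomy M 0 Vf Cf) (d : Fin 6 → Dir) :
    ∃ (x : Fin 3 → V) (y : Fin 6 → V) (c : Fin 3 × Fin 6 → C), Function.Injective x ∧
      Function.Injective y ∧ Function.Injective c ∧ (∀ i, x i ∈ Vf) ∧ (∀ q, y q ∈ Vf) ∧
      (∀ p, c p ∈ Cf) ∧ ∀ i q, D.DArc (d q) (x i) (y q) (c (i, q)) := by
  classical
  -- Disjoint colour sets are used for the out- and in-edges at `x`, so the chosen edges have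
  -- distinct colours even across directions. The summand 6 pays for the six vertices `y q` chosen
  -- later.
  have hlocal : ∀ x ∈ Vf, ∃ (B : Dir → Finset V) (κ : Dir → V → C), ∀ i, B i ⊆ Vf ∧
      α / 20 * n + 6 ≤ (B i).card ∧ (∀ u ∈ B i, κ i u ∈ Cf ∧ D.DArc i x u (κ i u)) ∧
      ∀ j, ∀ u ∈ B i, ∀ u' ∈ B j, κ i u = κ j u' → u = u' := by
    intro x hx
    have hxD := hroom.verts_subset x hx
    obtain ⟨K, hK, K', hK', hdisj, hKs, hKt, hKc, hKc'⟩ :=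
      h.exists_disjoint_colors hn (by linarith) hM hroom hxD hxD .fwd .bwd
    have hpos : 0 < ⌈α * n / 8⌉₊ := Nat.ceil_pos.2 (by linarith)
    obtain ⟨B, hB, hBc, κ, hκ, hinj⟩ :=
      hroom.exists_representatives (Finset.card_pos.1 (hKc ▸ hpos)) hKs
    obtain ⟨B', hB', hBc', κ', hκ', hinj'⟩ :=
      hroom.exists_representatives (Finset.card_pos.1 (hKc' ▸ hpos)) hKt
    have hceil' : α * n / 8 ≤ (⌈α * n / 8⌉₊ : ℝ) := Nat.le_ceil _
    have hBr : (⌈α * n / 8⌉₊ : ℝ) ≤ B.card + M := by rw [← hKc]; exact_mod_cast hBc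
    have hBr' : (⌈α * n / 8⌉₊ : ℝ) ≤ B'.card + M := by rw [← hKc']; exact_mod_cast hBc'
    refine ⟨fun i => match i with | .fwd => B | .bwd => B',
      fun i => match i with | .fwd => κ | .bwd => κ', fun i => ?_⟩
    cases i with
    | fwd =>
      refine ⟨hB, by dsimp only; linarith, fun u hu => ⟨hK (hκ u hu).1, (hκ u hu).2⟩, fun j u hu u' hu' he => ?_⟩
      cases j with
      | fwd => exact hinj hu hu' he
      | bwd =>
        have h1 := (hκ u hu).1
        dsimp only at he
        rw [he] at h1
        exact absurd (hκ' u' hu').1 (Finset.disjoint_left.1 hdisj h1)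
    | bwd =>
      refine ⟨hB', by dsimp only; linarith, fun u hu => ⟨hK' (hκ' u hu).1, (hκ' u hu).2⟩, fun j u hu u' hu' he => ?_⟩
      cases j with
      | bwd => exact hinj' hu hu' he
      | fwd =>
        have h1 := (hκ u' hu').1
        dsimp only at he
        rw [← he] at h1
        exact absurd (hκ' u hu).1 (Finset.disjoint_left.1 hdisj h1)
  have hnr : (0 : ℝ) < n := by exact_mod_cast hn
  have hαn : α * n ≤ n := mul_le_of_le_one_left hnr.le hα1
  have hVfc : (n : ℝ) / 2 ≤ Vf.card := by
    have h1 := hroom.card_verts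
    rw [h.card_verts] at h1
    have : (n : ℝ) ≤ Vf.card + M := by exact_mod_cast h1
    linarith
  have hVfn : (Vf.card : ℝ) ≤ n := by
    have : (Vf : Set V).ncard ≤ D.verts.ncard :=
      Set.ncard_le_ncard (fun v hv => hroom.verts_subset v hv) D.finite_verts
    rw [Set.ncard_coe_finset, h.card_verts] at this
    exact_mod_cast this
  have hVfne : Vf.Nonempty := by
    rw [← Finset.card_pos]
    have : (0 : ℝ) < Vf.card := by linarith
    exact_mod_cast this
  obtain ⟨v₀, hv₀⟩ := hVfne
  obtain ⟨c₀, -⟩ := Set.nonempty_of_ncard_ne_zero (s := D.colors) (by rw [h.card_colors]; omega)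
  have : Nonempty C := ⟨c₀⟩
  choose! B κ hB hBc hκ hinj using hlocal
  obtain ⟨y, hy, hyV, X, hX, hXc, hXB⟩ := exists_popular_fin Vf (fun i x => B x i) (α / 20) n
    (by positivity) hnr hVfn 6 6 d Vf ∅ ⟨v₀, hv₀⟩ (by simp) (fun i x hx => hB x hx i)
    (fun i x hx => by exact_mod_cast hBc x hx i)
  let c : V → Fin 6 → C := fun x q => κ x (d q) (y q)
  have harc : ∀ x ∈ X, ∀ q, D.DArc (d q) x (y q) (c x q) := fun x hx q =>
    (hκ x (hX hx) (d q) (y q) (hXB x hx q)).2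
  have hcC : ∀ x ∈ X, ∀ q, c x q ∈ Cf := fun x hx q =>
    (hκ x (hX hx) (d q) (y q) (hXB x hx q)).1
  have hcinj : ∀ x ∈ X, Function.Injective (c x) := fun x hx q q' he =>
    hy (hinj x (hX hx) (d q) (d q') (y q) (hXB x hx q) (y q') (hXB x hx q') he)
  -- The stars at the `x ∈ X` are each rainbow; `conf z` holds those sharing a colour with the star
  -- at `z`. Each of the 36 pairs of positions accounts for at most `n / log n` of them, by the
  -- bound on colour degrees at the `y q`.
  let conf : V → Finset V := fun z => X.filter fun x => ∃ q q', c x q = c z q'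
  have hconf : ∀ z ∈ X, ((conf z).card : ℝ) ≤ 36 * (n / Real.log n) := by
    intro z hz
    have h1 : conf z ⊆ (Finset.univ : Finset (Fin 6 × Fin 6)).biUnion fun p =>
        X.filter fun x => c x p.1 = c z p.2 := by
      intro x hx
      obtain ⟨hxX, q, q', hqq⟩ := Finset.mem_filter.1 hx
      exact Finset.mem_biUnion.2 ⟨(q, q'), Finset.mem_univ _, Finset.mem_filter.2 ⟨hxX, hqq⟩⟩
    have h2 : ∀ p : Fin 6 × Fin 6, ((X.filter fun x => c x p.1 = c z p.2).card : ℝ) ≤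
        n / Real.log n := by
      intro p
      refine le_trans ?_ (h.color_degree (c z p.2) (hroom.colors_subset _ (hcC z hz _)) (y p.1)
        (hroom.verts_subset _ (hyV _).1) (d p.1).flip)
      rw [← Set.ncard_coe_finset]
      have hfin : (D.nbhdOfColor (d p.1).flip (c z p.2) (y p.1)).Finite :=
        D.finite_verts.subset fun u hu => DArc.right_mem hu
      refine Nat.cast_le.2 (Set.ncard_le_ncard ?_ hfin)
      intro x hx
      obtain ⟨hxX, hxc⟩ := Finset.mem_filter.1 hx
      have := (harc x hxX p.1).symm
      rw [hxc] at this
      exact this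
    calc ((conf z).card : ℝ) ≤ ∑ p : Fin 6 × Fin 6, ((X.filter fun x => c x p.1 = c z p.2).card : ℝ) := by
          exact_mod_cast (Finset.card_le_card h1).trans Finset.card_biUnion_le
      _ ≤ ∑ _p : Fin 6 × Fin 6, n / Real.log n := Finset.sum_le_sum fun p _ => h2 p
      _ = _ := by simp
  -- Enough to choose a third centre outside two conflict sets, since `72 = 2 * 36`.
  have hXlarge : 72 * (n / Real.log n) < (X.card : ℝ) := by
    refine hlog.trans_le (le_trans ?_ hXc)
    gcongr
  have hlogpos : 0 ≤ n / Real.log n := div_nonneg hnr.le (Real.log_natCast_nonneg n)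
  have hpick : ∀ Q : Finset V, (Q.card : ℝ) ≤ 72 * (n / Real.log n) → ∃ x ∈ X, x ∉ Q := by
    intro Q hQ
    have h1 : Q.card < X.card := by exact_mod_cast hQ.trans_lt hXlarge
    obtain ⟨x, hx⟩ := Finset.card_pos.1 (show 0 < (X \ Q).card by
      have := Finset.le_card_sdiff Q X; omega)
    exact ⟨x, (Finset.mem_sdiff.1 hx).1, (Finset.mem_sdiff.1 hx).2⟩
  obtain ⟨x₀, hx0, -⟩ := hpick ∅ (by simpa using hlogpos)
  obtain ⟨x₁, hx1, hx1'⟩ := hpick (conf x₀) (by have := hconf x₀ hx0; linarith)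
  obtain ⟨x₂, hx2, hx2'⟩ := hpick (conf x₀ ∪ conf x₁) (by
    have h1 := hconf x₀ hx0
    have h2 := hconf x₁ hx1
    have h3 : ((conf x₀ ∪ conf x₁).card : ℝ) ≤ (conf x₀).card + (conf x₁).card := by
      exact_mod_cast Finset.card_union_le _ _
    linarith)
  rw [Finset.mem_union, not_or] at hx2'
  have hnc : ∀ a ∈ X, ∀ b, a ∉ conf b → ∀ q q', c a q ≠ c b q' := fun a ha b hab q q' he =>
    hab (Finset.mem_filter.2 ⟨ha, q, q', he⟩)
  have h10 := hnc x₁ hx1 x₀ hx1'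
  have h20 := hnc x₂ hx2 x₀ hx2'.1
  have h21 := hnc x₂ hx2 x₁ hx2'.2
  let x : Fin 3 → V := ![x₀, x₁, x₂]
  have hxX : ∀ i, x i ∈ X := by
    intro i
    fin_cases i <;> assumption
  have hne : ∀ i j, i ≠ j → ∀ q q', c (x i) q ≠ c (x j) q' := by
    intro i j hij q q'
    fin_cases i <;> fin_cases j <;> first
      | exact absurd rfl hij
      | exact h10 q q'
      | exact h20 q q'
      | exact h21 q q'
      | exact (h10 q' q).symm
      | exact (h20 q' q).symm
      | exact (h21 q' q).symm
  refine ⟨x, y, fun p => c (x p.1) p.2, ?_, hy, ?_, fun i => hX (hxX i), fun q => (hyV q).1,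
    fun p => hcC _ (hxX _) _, fun i q => harc _ (hxX i) q⟩
  · intro i j hij
    by_contra hne'
    exact hne i j hne' 0 0 (by rw [hij])
  · rintro ⟨i, q⟩ ⟨j, q'⟩ he
    by_cases hij : i = j
    · subst hij
      exact congrArg _ (hcinj _ (hxX i) he)
    · exact absurd he (hne i j hij q q')

end ColoredDigraph

/-! ### The switch built from a rainbow `K₃,₆`. -/

namespace ColoredDigraph

variable {V C : Type*}

theorem IsEdgeColorPseudorandom.hasSlots {D : ColoredDigraph V C} {n M : ℕ} {α ε : ℝ}
    (h : D.IsEdgeColorPseudorandom n α ε) (hα0 : 0 < α) (hn : 0 < n) (hα1 : α ≤ 1)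
    (hα : 1000 ≤ α * n) (hM : (M : ℝ) ≤ α * n / 50)
    (hlog : 72 * (n / Real.log n) < (α / 20) ^ 6 * (n / 2)) (hC : D.Connects M) : D.HasSlots M := by
  classical
  intro Vf Cf hroom w hw
  match w, hw with
  | [d₀, d₁, d₂, d₃, d₄, d₅, d₆, d₇, d₈, d₉, d₁₀, d₁₁], _ =>
  -- The path enters each `x` from `y 0`, `y 2` or `y 4`, against the `x`-to-`y` convention of the
  -- biclique; hence the flipped directions.
  obtain ⟨x, y, c, hx, hy, hc, hxV, hyV, hcC, harc⟩ := h.exists_rainbow_biclique hα0 hn hα1 hα hM hlog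
    (hroom.mono (Nat.zero_le _)) ![d₀.flip, d₁, d₅.flip, d₆, d₁₀.flip, d₁₁]
  -- The 14 edges used by at least one of the three arrangements of the `x`'s; `(1, 4)`, `(1, 5)`,
  -- `(2, 2)`, `(2, 3)` are never used.
  let a : Fin 14 → Fin 3 × Fin 6 := ![(0, 0), (0, 1), (1, 2), (1, 3), (2, 4), (2, 5), (1, 0), (1, 1),
    (2, 0), (2, 1), (0, 2), (0, 3), (0, 4), (0, 5)]
  have ha : Function.Injective a := by decide
  have hyD : ∀ q, y q ∈ D.verts := fun q => hroom.verts_subset _ (hyV q)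
  let Y : Multiset V := {y 0, y 1, y 2, y 3, y 4, y 5}
  let Z : Multiset V := {x 0, x 1, x 2}
  let N : Multiset C := (List.ofFn fun i => c (a i) : List C)
  have hyY : ∀ q, y q ∈ Y := by
    intro q
    fin_cases q <;> simp [Y]
  have hxZ : ∀ i, x i ∈ Z := by
    intro i
    fin_cases i <;> simp [Z]
  have hcN : ∀ i, c (a i) ∈ N := fun i => List.mem_ofFn.2 ⟨i, rfl⟩
  have hNcard : N.card = 14 := by simp [N]
  obtain ⟨u, hu, v, hv, huv, k₁, hk1, k₂, hk2, k₃, hk3, hk12, hk13, hk23, he1, he2, he3⟩ :=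
    hC _ _ (hroom.shrink (ℓ' := 0) (Y + Z) N (by simp [Y, Z]) (by omega)) (y 1) (hyD 1)
      (y 2) (hyD 2) (by simp [hyY]) (by simp [hyY]) d₂ d₃ d₄
  obtain ⟨u', hu', v', hv', huv', k₄, hk4, k₅, hk5, k₆, hk6, hk45, hk46, hk56, he4, he5, he6⟩ :=
    hC _ _ (hroom.shrink (ℓ' := 0) (Y + Z + {u, v}) (N + {k₁, k₂, k₃}) (by simp [Y, Z])
      (by simp [hNcard])) (y 3) (hyD 3) (y 4) (hyD 4) (by simp [hyY]) (by simp [hyY]) d₇ d₈ d₉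
  rw [Finset.mem_sdiff, Multiset.mem_toFinset] at hu hv hk1 hk2 hk3 hu' hv' hk4 hk5 hk6
  -- Each `x` is joined to every `y q` in the direction prescribed for `q`, so any of the three can
  -- stand in any of the three gaps. The modes needed are the identity and two transpositions.
  have hmodes : ∀ i j k : Fin 3, D.Realizes [d₀, d₁, d₂, d₃, d₄, d₅, d₆, d₇, d₈, d₉, d₁₀, d₁₁]
      (y 0) (y 5)
      ([x i, y 1, u, v, y 2, x j, y 3, u', v', y 4, x k, y 5] : List V)
      ([c (i, 0), c (i, 1), k₁, k₂, k₃, c (j, 2), c (j, 3), k₄, k₅, k₆, c (k, 4), c (k, 5)] : List C) := by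
    intro i j k
    refine ⟨_, _, ?_, rfl, rfl⟩
    exact .cons (harc i 0).symm' (.cons (harc i 1) (.cons he1 (.cons he2 (.cons he3
      (.cons (harc j 2).symm' (.cons (harc j 3) (.cons he4 (.cons he5 (.cons he6
        (.cons (harc k 4).symm' (.cons (harc k 5) (.nil _))))))))))))
  have hverts : y 0 ::ₘ (([x 0, y 1, u, v, y 2, x 1, y 3, u', v', y 4, x 2, y 5] : List V) : Multiset V)
      = Y + Z + {u, v} + {u', v'} := by
    simp only [Y, Z, Multiset.insert_eq_cons, ← Multiset.cons_coe, ← Multiset.singleton_add,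
      Multiset.coe_nil, add_zero]
    abel
  have hYnd : Y.Nodup := by
    have : Y = (List.ofFn y : List V) := by
      simp only [Y, List.ofFn_succ, List.ofFn_zero]
      rfl
    rw [this]
    exact Multiset.coe_nodup.2 (List.nodup_ofFn.2 hy)
  have hZnd : Z.Nodup := by
    have : Z = (List.ofFn x : List V) := by
      simp only [Z, List.ofFn_succ, List.ofFn_zero]
      rfl
    rw [this]
    exact Multiset.coe_nodup.2 (List.nodup_ofFn.2 hx)
  have hYV : ∀ z ∈ Y, ∃ q, z = y q := by
    intro z hz
    simp only [Y, Multiset.insert_eq_cons, Multiset.mem_cons, Multiset.mem_singleton] at hz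
    rcases hz with rfl | rfl | rfl | rfl | rfl | rfl <;> exact ⟨_, rfl⟩
  have hZV : ∀ z ∈ Z, ∃ i, z = x i := by
    intro z hz
    simp only [Z, Multiset.insert_eq_cons, Multiset.mem_cons, Multiset.mem_singleton] at hz
    rcases hz with rfl | rfl | rfl <;> exact ⟨_, rfl⟩
  have hnd : (Y + Z + {u, v} + {u', v'}).Nodup := by
    refine Multiset.nodup_add.2 ⟨Multiset.nodup_add.2 ⟨Multiset.nodup_add.2 ⟨hYnd, hZnd, ?_⟩, ?_, ?_⟩, ?_, ?_⟩
    · rw [Multiset.disjoint_left]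
      intro z hz hz'
      obtain ⟨q, rfl⟩ := hYV z hz
      obtain ⟨i, hi⟩ := hZV _ hz'
      exact (harc i q).ne hi.symm
    · simpa using huv
    · rw [Multiset.disjoint_right]
      intro z hz
      simp only [Multiset.insert_eq_cons, Multiset.mem_cons, Multiset.mem_singleton] at hz
      rcases hz with rfl | rfl
      exacts [hu.2, hv.2]
    · simpa using huv'
    · rw [Multiset.disjoint_right]
      intro z hz
      simp only [Multiset.insert_eq_cons, Multiset.mem_cons, Multiset.mem_singleton] at hz
      rcases hz with rfl | rfl
      exacts [hu'.2, hv'.2]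
  have hmem : ∀ z ∈ Y + Z + {u, v} + {u', v'}, z ∈ Vf := by
    intro z hz
    simp only [Multiset.mem_add, Multiset.insert_eq_cons, Multiset.mem_cons,
      Multiset.mem_singleton] at hz
    rcases hz with ((hz | hz) | rfl | rfl) | rfl | rfl
    · obtain ⟨q, rfl⟩ := hYV z hz
      exact hyV q
    · obtain ⟨i, rfl⟩ := hZV z hz
      exact hxV i
    exacts [hu.1, hv.1, hu'.1, hv'.1]
  rw [← hverts] at hnd hmem
  have hcolors : ∀ k ∈ ({k₁, k₂, k₃} + {k₄, k₅, k₆} : Multiset C), k ∈ Cf ∧ k ∉ N := by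
    intro k hk
    simp only [Multiset.mem_add, Multiset.insert_eq_cons, Multiset.mem_cons,
      Multiset.mem_singleton] at hk
    rcases hk with (rfl | rfl | rfl) | rfl | rfl | rfl
    · exact hk1
    · exact hk2
    · exact hk3
    · exact ⟨hk4.1, fun hk => hk4.2 (Multiset.mem_add.2 (Or.inl hk))⟩
    · exact ⟨hk5.1, fun hk => hk5.2 (Multiset.mem_add.2 (Or.inl hk))⟩
    · exact ⟨hk6.1, fun hk => hk6.2 (Multiset.mem_add.2 (Or.inl hk))⟩
  refine ⟨fun i => c (a i), hc.comp ha, fun i => hcC _, y 0, y 5,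
    ([x 0, y 1, u, v, y 2, x 1, y 3, u', v', y 4, x 2, y 5] : List V),
    {k₁, k₂, k₃} + {k₄, k₅, k₆}, ⟨hyV 0, hnd, fun z hz => hmem z (Multiset.mem_cons_of_mem hz),
      by simp, ?_, fun k hk => (hcolors k hk).1, by simp, by simp, ?_⟩, ?_⟩
  · refine Multiset.nodup_add.2 ⟨by simp [hk12, hk13, hk23], by simp [hk45, hk46, hk56], ?_⟩
    rw [Multiset.disjoint_right]
    intro k hk
    simp only [Multiset.insert_eq_cons, Multiset.mem_cons, Multiset.mem_singleton] at hk
    rcases hk with rfl | rfl | rfl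
    · exact fun hk => hk4.2 (Multiset.mem_add.2 (Or.inr hk))
    · exact fun hk => hk5.2 (Multiset.mem_add.2 (Or.inr hk))
    · exact fun hk => hk6.2 (Multiset.mem_add.2 (Or.inr hk))
  · rintro E (rfl | rfl | rfl)
    · convert hmodes 0 1 2 using 1
      simp only [a, Multiset.insert_eq_cons, ← Multiset.cons_coe, ← Multiset.singleton_add,
        Multiset.coe_nil, add_zero]
      simp only [Matrix.cons_val]
      abel
    · convert hmodes 1 0 2 using 1
      · simp only [← Multiset.cons_coe, ← Multiset.singleton_add]
        abel
      · simp only [a, Multiset.insert_eq_cons, ← Multiset.cons_coe, ← Multiset.singleton_add,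
          Multiset.coe_nil, add_zero]
        simp only [Matrix.cons_val]
        abel
    · convert hmodes 2 1 0 using 1
      · simp only [← Multiset.cons_coe, ← Multiset.singleton_add]
        abel
      · simp only [a, Multiset.insert_eq_cons, ← Multiset.cons_coe, ← Multiset.singleton_add,
          Multiset.coe_nil, add_zero]
        simp only [Matrix.cons_val]
        abel
  · intro k hk i hki
    exact (hcolors k hk).2 (hki ▸ hcN i)

end ColoredDigraph

/-! ### Assembling the absorber. -/

namespace ColoredDigraph

variable {V C : Type*}

theorem vertexPart_image_inr (U : Set C) : vertexPart (Sum.inr '' U : Set (V ⊕ C)) = ∅ := by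
  ext v
  simp [vertexPart]

theorem colorPart_image_inr (U : Set C) : colorPart (Sum.inr '' U : Set (V ⊕ C)) = U := by
  ext c
  simp [colorPart]

/-- A piece for the `m`-subsets of `X` is an absorber for them. -/
theorem Piece.hasAbsorber {D : ColoredDigraph V C} {k m : ℕ} {σ : Fin k → Dir} {Vf : Finset V}
    {Cf X : Finset C} {s t : V} {W : Multiset V} {I : Multiset C} (hm : 0 < m) (hX : m ≤ X.card)
    (hVf : ∀ v ∈ Vf, v ∈ D.verts) (hXC : Disjoint X Cf)
    (h : D.Piece (List.ofFn σ) Vf Cf {E | ∃ U ⊆ X, U.card = m ∧ E = U.val} s t W I) :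
    D.HasAbsorber (colorSubsets (X : Set C) m) σ Vf Cf := by
  classical
  -- Keeping every admissible arc makes `A` contain the paths for all `U` at once. Further arcs are
  -- harmless: the definition of an absorber sees only the vertex set and the colour set of `A`.
  let A : ColoredDigraph V C :=
    { verts := {v | v ∈ s ::ₘ W}
      Arc := fun u v c => D.Arc u v c ∧ u ∈ s ::ₘ W ∧ v ∈ s ::ₘ W ∧ (c ∈ I ∨ c ∈ X)
      finite_verts := by
        refine (s ::ₘ W).toFinset.finite_toSet.subset fun v hv => ?_
        exact Finset.mem_coe.2 (Multiset.mem_toFinset.2 hv)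
      arc_left_mem := fun h => h.2.1
      arc_right_mem := fun h => h.2.2.1
      arc_ne := fun h => D.arc_ne h.1
      arc_unique := fun h h' => D.arc_unique h.1 h'.1 }
  have hIX : ∀ c ∈ I, c ∉ X := fun c hc hcX => Finset.disjoint_left.1 hXC hcX (h.colors_mem c hc)
  have hpath : ∀ U ⊆ X, U.card = m → ∃ P : ColoredDigraph V C, P.IsSubdigraph A ∧ P.IsRainbow ∧
      P.IsDirectedPath σ s t ∧ P.verts = A.verts ∧ P.colors = {c | c ∈ I ∨ c ∈ U} := by
    intro U hU hUm
    obtain ⟨P, h1, h2, h3, h4, h5⟩ := (h.realizes U.val ⟨U, hU, hUm, rfl⟩).exists_path (A := A) h.nodup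
      (Multiset.nodup_add.2 ⟨h.colors_nodup, U.nodup,
        Multiset.disjoint_left.2 fun hc hcU => hIX _ hc (hU hcU)⟩) (fun v hv => hv)
      (fun u v c ha hu hv hc => ⟨ha, hu, hv, (Multiset.mem_add.1 hc).imp_right fun hc => hU hc⟩)
    refine ⟨P, h1, h2, h3, h4, ?_⟩
    rw [h5]
    ext c
    simp
  -- As `0 < m ≤ |X|`, some `m`-subset exists, which shows the colours of `I`, and every colour of
  -- `X` lies in one.
  have hcol : A.colors = {c | c ∈ I ∨ c ∈ X} := by
    have hsub : ∀ U ⊆ X, U.card = m → ∀ c, c ∈ I ∨ c ∈ U → c ∈ A.colors := by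
      intro U hU hUm c hc
      obtain ⟨P, hPA, -, -, -, hPc⟩ := hpath U hU hUm
      have : c ∈ P.colors := by rw [hPc]; exact hc
      obtain ⟨u, v, huv⟩ := this
      exact ⟨u, v, hPA.2 huv⟩
    ext c
    constructor
    · rintro ⟨u, v, huv⟩
      exact huv.2.2.2
    · rintro (hc | hc)
      · obtain ⟨U, hU, hUm⟩ := Finset.exists_subset_card_eq hX
        exact hsub U hU hUm c (Or.inl hc)
      · obtain ⟨U, hcU, hU, hUm⟩ := Finset.exists_subsuperset_card_eq
          (Finset.singleton_subset_iff.2 hc) (by simpa using Nat.succ_le_of_lt hm) hX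
        exact hsub U hU hUm c (Or.inr (hcU (Finset.mem_singleton_self c)))
  have hvp : vertexPart (⋃₀ (colorSubsets (X : Set C) m : Set (Set (V ⊕ C)))) = ∅ := by
    ext v
    simp only [vertexPart, Set.mem_ofPred_eq, Set.mem_sUnion, Set.mem_empty_iff_false, iff_false]
    rintro ⟨S, ⟨U, -, -, rfl⟩, hv⟩
    simp at hv
  have hcp : colorPart (⋃₀ (colorSubsets (X : Set C) m : Set (Set (V ⊕ C)))) = X := by
    ext c
    constructor
    · rintro ⟨S, ⟨U, hU, -, rfl⟩, hc⟩
      exact hU (by simpa using hc)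
    · intro hc
      obtain ⟨U, hcU, hU, hUm⟩ := Finset.exists_subsuperset_card_eq
        (Finset.singleton_subset_iff.2 (Finset.mem_coe.1 hc)) (by simpa using Nat.succ_le_of_lt hm) hX
      exact ⟨Sum.inr '' (U : Set C), ⟨U, Finset.coe_subset.2 hU, by simp [hUm], rfl⟩,
        c, hcU (Finset.mem_singleton_self c), rfl⟩
  have hiv : A.internalVerts (colorSubsets (X : Set C) m) = A.verts := by
    rw [internalVerts, hvp, Set.sdiff_empty]
  have hic : A.internalColors (colorSubsets (X : Set C) m) = {c | c ∈ I} := by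
    rw [internalColors, hcp, hcol]
    ext c
    simp only [Set.mem_sdiff, Set.mem_ofPred_eq, Finset.mem_coe]
    have := hIX c
    tauto
  refine ⟨A, s, t, ⟨fun v hv => hVf v (h.mem_of_mem_cons v hv), fun u v c hc => hc.1⟩,
    ⟨?_, Multiset.mem_cons_self _ _, h.end_mem, ?_⟩, ?_, ?_⟩
  · rintro _ ⟨U, -, hU, rfl⟩ _ ⟨U', -, hU', rfl⟩
    rw [vertexPart_image_inr, vertexPart_image_inr, colorPart_image_inr, colorPart_image_inr, hU, hU']
    exact ⟨rfl, rfl⟩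
  · rintro _ ⟨U, hU, hUm, rfl⟩
    obtain ⟨U, rfl⟩ := (X.finite_toSet.subset hU).exists_finset_coe
    rw [Set.encard_coe_eq_coe_finsetCard, Nat.cast_inj] at hUm
    obtain ⟨P, h1, h2, h3, h4, h5⟩ := hpath U (Finset.coe_subset.1 hU) hUm
    refine ⟨P, h1, h2, h3, ?_, ?_⟩
    · rw [vertexPart_image_inr, hiv, h4, Set.union_empty]
    · rw [colorPart_image_inr, hic, h5]
      rfl
  · rw [hiv]
    exact fun v hv => h.mem_of_mem_cons v hv
  · rw [hic]
    exact fun c hc => h.colors_mem c hc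

/-- One flexible piece is placed for each slot of the robustly matchable graph. The room is for `2 k
+ 10` vertices and colours, as flexibility along `σ` demands, and for at most `4 m` colours of `X`
and `Y`. -/
theorem hasAbsorber_colorSubsets {D : ColoredDigraph V C} {M : ℕ} (hC : D.Connects M)
    (hE : D.Extends M) (hW : D.HasWires M) (hS : D.HasSlots M) (hM : M ≤ D.verts.ncard)
    {m k : ℕ} (hm : 100 ≤ m) (hk : k + 3 = 2784 * (3 * m)) (σ : Fin k → Dir) (Vf : Finset V)
    (Cf X : Finset C) (hVf : ∀ v ∈ Vf, v ∈ D.verts) (hCf : ∀ c ∈ Cf, c ∈ D.colors)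
    (hX : ∀ c ∈ X, c ∈ D.colors) (hVc : D.verts.ncard + (2 * k + 10) ≤ Vf.card + M)
    (hCc : D.verts.ncard + (2 * k + 10) + 4 * m ≤ Cf.card + M) (hXm : m ≤ X.card)
    (hX2m : X.card ≤ 2 * m) : D.HasAbsorber (colorSubsets (X : Set C) m) σ Vf Cf := by
  classical
  have hCX := Finset.le_card_sdiff X Cf
  obtain ⟨Y, hY, hYc⟩ := Finset.exists_subset_card_eq (show 2 * m ≤ (Cf \ X).card by omega)
  have hXY : Disjoint X Y := (Finset.disjoint_of_subset_left hY Finset.sdiff_disjoint).symm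
  obtain ⟨N, hNs, hNne, hNc, hNm⟩ := exists_robustly_matchable m hm X Y hXY hX2m hYc
  have hYD : ∀ c ∈ Y, c ∈ D.colors := fun c hc => hCf c (Finset.mem_sdiff.1 (hY hc)).1
  have hlist := FlexibleFrom.list hC (fun S => 105 * S.card - 3) (List.ofFn N)
    (by rw [ne_eq, List.ofFn_eq_nil_iff]; omega) (by
      intro S hS'
      obtain ⟨z, rfl⟩ := List.mem_ofFn.1 hS'
      have hpos := Finset.card_pos.2 (hNne z)
      obtain ⟨j, hj⟩ : ∃ j, (N z).card = j + 1 := ⟨(N z).card - 1, by omega⟩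
      have := flexibleFrom_singletons hC hE hW hS j (N z) hj (fun c hc => by
        rcases Finset.mem_union.1 (hNs z hc) with hc | hc
        · exact hX c hc
        · exact hYD c hc) hM
      rwa [← hj] at this)
  -- A slot of degree `d` costs `105 d` including its joining path, in total at most `105 * 70 m =
  -- 7350 m`, while `2784 * 3 m = 8352 m` is available.
  have hlen : ((List.ofFn N).map fun S => 105 * S.card - 3 + 3).sum - 3 ≤ (List.ofFn σ).length := by
    have : ((List.ofFn N).map fun S => 105 * S.card - 3 + 3).sum ≤ 105 * (70 * m) := by
      rw [List.map_ofFn, List.sum_ofFn]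
      calc ∑ z, (105 * (N z).card - 3 + 3) ≤ ∑ z, 105 * (N z).card :=
            Finset.sum_le_sum fun z _ => by have := Finset.card_pos.2 (hNne z); omega
        _ = 105 * ∑ z, (N z).card := by rw [Finset.mul_sum]
        _ ≤ _ := Nat.mul_le_mul_left _ hNc
    rw [List.length_ofFn]
    omega
  obtain ⟨s, t, W, I, hp⟩ := hlist (List.ofFn σ) hlen Vf ((Cf \ X) \ Y)
    ⟨hVf, fun c hc => hCf c (Finset.mem_sdiff.1 (Finset.mem_sdiff.1 hc).1).1,
      by rw [List.length_ofFn]; omega, by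
        have := Finset.le_card_sdiff Y (Cf \ X)
        rw [List.length_ofFn]
        omega⟩
  -- Every matching used covers all of `Y`, so `Y` turns internal and only the choice of `U` is
  -- left.
  have hp' := hp.absorb (Cf' := Cf \ X) (N := Y.val) (ℰ' := {E | ∃ U ⊆ X, U.card = m ∧ E = U.val})
    Finset.sdiff_subset Y.nodup (fun c hc => hY hc) (fun c hc hc' => (Finset.mem_sdiff.1 hc').2 hc)
    (by
      obtain ⟨U, hU, hUm⟩ := Finset.exists_subset_card_eq hXm
      exact ⟨_, U, hU, hUm, rfl⟩) (by
      rintro _ ⟨U, hU, hUm, rfl⟩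
      obtain ⟨φ, hφ, hφN, hφi⟩ := hNm U hU hUm
      refine ⟨List.ofFn φ, ?_, ?_⟩
      · rw [List.forall₂_iff_get]
        refine ⟨by simp, fun i h1 h2 => ?_⟩
        simpa using hφN ⟨i, by simpa using h1⟩
      · refine (Multiset.Nodup.ext ?_ (Multiset.coe_nodup.2 (List.nodup_ofFn.2 hφ))).2 fun c => ?_
        · exact Multiset.nodup_add.2 ⟨Y.nodup, U.nodup, Multiset.disjoint_left.2 fun hc hcU =>
            Finset.disjoint_left.1 hXY (hU hcU) hc⟩
        · have : c ∈ Finset.univ.image φ ↔ c ∈ U ∪ Y := by rw [hφi]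
          simp only [Finset.mem_image, Finset.mem_univ, true_and, Finset.mem_union] at this
          rw [Multiset.mem_add, Multiset.mem_coe, List.mem_ofFn, Finset.mem_val, Finset.mem_val]
          exact or_comm.trans this.symm)
  obtain ⟨A, s, t, h1, h2, h3, h4⟩ := hp'.hasAbsorber (by omega) hXm hVf Finset.disjoint_sdiff
  exact ⟨A, s, t, h1, h2, h3, h4.trans (Finset.coe_subset.2 Finset.sdiff_subset)⟩

end ColoredDigraph

/-! ### The choice of constants. -/

theorem lemma6p3 :
    ∀ α : ℝ, 0 < α → α ≤ 1 →
    ∃ ν₀ : ℝ, 0 < ν₀ ∧ ∀ ν : ℝ, 0 < ν → ν ≤ ν₀ →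
    ∃ μ₀ : ℝ, 0 < μ₀ ∧ ∀ μ : ℝ, 0 < μ → μ ≤ μ₀ →
    ∀ β : ℝ, 0 < β → β ≤ μ →
    ∃ ε₀ : ℝ, 0 < ε₀ ∧ ∀ ε : ℝ, 0 < ε → ε ≤ ε₀ →
    ∃ n₀ : ℕ, ∀ n : ℕ, n₀ ≤ n →
    ∀ (V C : Type*) (D : ColoredDigraph V C),
      D.IsEdgeColorPseudorandom n α ε →
      D.IsColorGadgetPseudorandom (4 * ν) →
    ∀ m k : ℕ, m = ⌊μ * n⌋₊ → k + 3 = 2784 * (3 * m) →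
    ∀ σ : Fin k → Dir,
    ∀ (V' : Set V) (C' : Set C), V' ⊆ D.verts → C' ⊆ D.colors →
      (1 - ν) * n ≤ V'.ncard → (1 - ν) * n ≤ C'.ncard →
    ∀ X : Set C, X ⊆ D.colors → X.ncard = ⌊μ * n⌋₊ + ⌊β * n⌋₊ →
      D.HasAbsorber (ColoredDigraph.colorSubsets X m) σ V' C' := by
  intro α hα hα1
  -- `α / 200` gives `4 ν n ≤ α n / 50`, the loss allowed in the connection lemmas. `ν / 100000`
  -- makes `2 k + 4 m + 11` at most `3 ν n`, the gap between the `ν n` missing from `V'`, `C'` and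
  -- the `4 ν n` that may be missing.
  refine ⟨α / 200, by positivity, fun ν hν hνα => ⟨ν / 100000, by positivity,
    fun μ hμ hμν β hβ hβμ => ⟨α / 50, by positivity, fun ε _ hεα => ?_⟩⟩⟩
  -- The summands ensure `α n ≥ 1000`, `m ≥ 100`, room for additive constants, and `log n > 144 (20
  -- / α) ^ 6`, which is what `hlog` needs.
  refine ⟨⌈1000 / α⌉₊ + ⌈101 / μ⌉₊ + ⌈100 / ν⌉₊ + ⌈Real.exp (145 * (20 / α) ^ 6)⌉₊,
    fun n hn V C D hD hDg m k hm hk σ V' C' hV' hC' hVc hCc X hX hXc => ?_⟩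
  have hlarge : ∀ x : ℝ, ⌈x⌉₊ ≤ n → x ≤ n := fun x hx =>
    (Nat.le_ceil x).trans (by exact_mod_cast hx)
  have hn1 : 1000 ≤ α * n := by
    have := hlarge (1000 / α) (by omega)
    rwa [div_le_iff₀ hα, mul_comm] at this
  have hn2 : 101 ≤ μ * n := by
    have := hlarge (101 / μ) (by omega)
    rwa [div_le_iff₀ hμ, mul_comm] at this
  have hn3 : 100 ≤ ν * n := by
    have := hlarge (100 / ν) (by omega)
    rwa [div_le_iff₀ hν, mul_comm] at this
  have hn4 : Real.exp (145 * (20 / α) ^ 6) ≤ n := hlarge _ (by omega)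
  have hn0 : 0 < n := by
    rcases Nat.eq_zero_or_pos n with rfl | h
    · simp at hn1; linarith
    · exact h
  have hnr : (0 : ℝ) < n := by exact_mod_cast hn0
  have hlog : 72 * ((n : ℝ) / Real.log n) < (α / 20) ^ 6 * (n / 2) := by
    have h1 : 145 * (20 / α) ^ 6 ≤ Real.log n := by
      rw [← Real.log_exp (145 * (20 / α) ^ 6)]
      exact Real.log_le_log (Real.exp_pos _) hn4
    have h2 : (0 : ℝ) < 145 * (20 / α) ^ 6 := by positivity
    calc 72 * ((n : ℝ) / Real.log n) ≤ 72 * (n / (145 * (20 / α) ^ 6)) := by gcongr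
      _ = (144 / 145) * ((α / 20) ^ 6 * (n / 2)) := by field_simp; norm_num
      _ < _ := by
        have : 0 < (α / 20) ^ 6 * ((n : ℝ) / 2) := by positivity
        linarith
  have hνn : ν * n ≤ α * n / 200 := by
    have := mul_le_mul_of_nonneg_right hνα hnr.le
    linarith
  have hμn : μ * n ≤ ν * n / 100000 := by
    have := mul_le_mul_of_nonneg_right hμν hnr.le
    linarith
  have hαn : α * n ≤ n := mul_le_of_le_one_left hnr.le hα1
  set M := ⌊4 * ν * n⌋₊ with hMdef
  have hM1 : (M : ℝ) ≤ 4 * ν * n := Nat.floor_le (by positivity)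
  have hM2 : 4 * ν * n < M + 1 := Nat.lt_floor_add_one _
  have hM3 : (M : ℝ) ≤ α * n / 50 := by linarith
  have hm1 : (m : ℝ) ≤ μ * n := by rw [hm]; exact Nat.floor_le (by positivity)
  have hm2 : 100 ≤ m := by rw [hm]; exact Nat.le_floor (by push_cast; linarith)
  -- This is where `β ≤ μ` enters: it gives `|X| ≤ 2 m`.
  have hb : ⌊β * n⌋₊ ≤ m := by rw [hm]; exact Nat.floor_le_floor (by gcongr)
  have hC := hD.connects hn0 hα1 (by linarith) hεα hM3
  have hE := hD.exits hn0 (by linarith) hM3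
  have hS := hD.hasSlots hα hn0 hα1 hn1 hM3 hlog hC
  have hW := hDg.hasWires (M := M) (by rw [hD.card_verts]; exact hM1)
  have hcolfin := hD.finite_colors hn0
  obtain ⟨Vf, rfl⟩ := (D.finite_verts.subset hV').exists_finset_coe
  obtain ⟨Cf, rfl⟩ := (hcolfin.subset hC').exists_finset_coe
  obtain ⟨X, rfl⟩ := (hcolfin.subset hX).exists_finset_coe
  rw [Set.ncard_coe_finset] at hVc hCc hXc
  have hkr : (k : ℝ) + 3 = 2784 * (3 * m) := by exact_mod_cast hk
  refine ColoredDigraph.hasAbsorber_colorSubsets hC hE hW hS ?_ hm2 hk σ Vf Cf X (fun v hv => hV' hv)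
    (fun c hc => hC' hc) (fun c hc => hX hc) ?_ ?_ (by omega) (by omega)
  · rw [hD.card_verts]
    have : (M : ℝ) ≤ n := by linarith
    exact_mod_cast this
  · rw [hD.card_verts]
    have : (n : ℝ) + (2 * k + 10) ≤ Vf.card + M := by linarith
    exact_mod_cast this
  · rw [hD.card_verts]
    have : (n : ℝ) + (2 * k + 10) + 4 * m ≤ Cf.card + M := by linarith
    exact_mod_cast this
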